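/- **Theorem (truncated spectral initialization).** There are numerical constants $0<c<1$ and $C\ge 1$ such that the following holds. Let $X^*=[x_1^*,\dots,x_q^*]\in\mathbb R^{n\times q}$ have rank $r\ge 1$ and reduced SVD $X^*=U^*\Sigma^*V^{*\top}=U^*B^*$, $B^*=[b_1^*,\dots,b_q^*]$; let $\sigma_{\max},\sigma_{\min}$ be the largest and smallest diagonal entries of $\Sigma^*$ and $\kappa=\sigma_{\max}/\sigma_{\min}$. Let $\mu\ge1$ be such that $\max_k\|b_k^*\|\le\mu\sqrt{r/q}\,\sigma_{\max}$. We observe $y_k=A_kx_k^*+v_k\in\mathbb R^m$ and $A_k\in\mathbb R^{m\times n}$, $k=1,\dots,q$, where all entries of all the $A_k$ and $v_k$ are mutually independent, the entries of the $A_k$ being $N(0,1)$ and those of the $v_k$ being $N(0,\sigma_v^2)$, $\sigma_v\ge 0$. Put $\mathrm{NSR}=q\sigma_v^2/\sigma_{\min}^2$, $\alpha=9\kappa^2\mu^2\frac1{mq}\sum_{k}\|y_k\|^2$, let $y_{k,\mathrm{trunc}}(\alpha)$ be $y_k$ with every entry of magnitude larger than $\sqrt\alpha$ set to zero, and let $\hat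 X_0=\frac1m\sum_{k=1}^q A_k^\top y_{k,\mathrm{trunc}}(\alpha)e_k^\top$. Let $0<\delta_0<0.1$. If $$mq> C\mu^2\kappa^2\left(\max(n,q)\,r\,\frac{\kappa^2}{\delta_0^2}+\frac{\max(n,q)}{\delta_0^2}\,\mathrm{NSR}\right),$$ then, with probability at least $1-\exp(-c(n+q))$, every matrix $U_0\in\mathbb R^{n\times r}$ whose columns are top-$r$ left singular vectors of $\hat X_0$ satisfies $$\mathrm{SD}_2(U^*,U_0):=\|(I-U^*U^{*\top})U_0\|\le\delta_0 ,$$ where $\|\cdot\|$ is the spectral norm. -/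

import Mathlib

open MeasureTheory ProbabilityTheory Matrix
open scoped NNReal Matrix

noncomputable section

namespace LRCS

/-- `X = U * diag(s) * Vᵀ` is a singular value decomposition with `p` singular triples: `U` and `V`
have orthonormal columns, and the singular values `s` are nonnegative and in decreasing order. -/
structure IsSVD {n q p : ℕ} (X : Matrix (Fin n) (Fin q) ℝ) (U : Matrix (Fin n) (Fin p) ℝ)
    (s : Fin p → ℝ) (V : Matrix (Fin q) (Fin p) ℝ) : Prop where
  left_orthonormal : Uᵀ * U = 1
  right_orthonormal : Vᵀ * V = 1
  nonneg : ∀ i, 0 ≤ s i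
  antitone : Antitone s
  eq : X = U * diagonal s * Vᵀ

/-- The columns of `U` are top-`r` left singular vectors of `X`: they are the first `r` left
singular vectors in some SVD of `X` with `min n q` singular triples. (If singular values
are repeated, there are several such `U`.) -/
def IsTopLeftSingularVectors {n q r : ℕ} (X : Matrix (Fin n) (Fin q) ℝ)
    (U : Matrix (Fin n) (Fin r) ℝ) : Prop :=
  ∃ (W : Matrix (Fin n) (Fin (min n q)) ℝ) (s : Fin (min n q) → ℝ)
    (V : Matrix (Fin q) (Fin (min n q)) ℝ) (h : r ≤ min n q),
    IsSVD X W s V ∧ ∀ i j, U i j = W i (Fin.castLE h j)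

/-- The largest singular value. -/
def sigmaMax {r : ℕ} (s : Fin r → ℝ) : ℝ := ⨆ i, s i

/-- The smallest singular value. -/
def sigmaMin {r : ℕ} (s : Fin r → ℝ) : ℝ := ⨅ i, s i

/-- The condition number. -/
def kappa {r : ℕ} (s : Fin r → ℝ) : ℝ := sigmaMax s / sigmaMin s

/-- The noise-to-signal ratio for `q` columns with noise standard deviation `σ`. -/
def NSR {r : ℕ} (q : ℕ) (σ : ℝ≥0) (s : Fin r → ℝ) : ℝ := q * (σ : ℝ) ^ 2 / sigmaMin s ^ 2

/-- Incoherence of the right singular vectors: every column `b_k` of `B = diag(s) * Vᵀ`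
satisfies `‖b_k‖ ≤ μ √(r/q) σ_max`. -/
def Incoherent {q r : ℕ} (s : Fin r → ℝ) (V : Matrix (Fin q) (Fin r) ℝ) (μ : ℝ) : Prop :=
  ∀ k, ‖WithLp.toLp 2 ((diagonal s * Vᵀ).col k)‖ ≤ μ * √((r : ℝ) / q) * sigmaMax s

section SubspaceDistance
open scoped Matrix.Norms.L2Operator

/-- The subspace distance `‖(I - U₁ U₁ᵀ) U₂‖` in the spectral norm. -/
def SD₂ {n r : ℕ} (U₁ U₂ : Matrix (Fin n) (Fin r) ℝ) : ℝ := ‖(1 - U₁ * U₁ᵀ) * U₂‖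

end SubspaceDistance

/-- The measurements `y_k = A_k x_k + v_k`, where `x_k` is the `k`-th column of `X`. -/
def measurements {n q m : ℕ} (X : Matrix (Fin n) (Fin q) ℝ)
    (A : Fin q → Matrix (Fin m) (Fin n) ℝ) (v : Fin q → Fin m → ℝ) : Fin q → Fin m → ℝ :=
  fun k => A k *ᵥ X.col k + v k

/-- The (squared) truncation level `α = 9 κ² μ² (1/(mq)) ∑_{i,k} y_{ik}²`. -/
def truncLevel {q m : ℕ} (κ μ : ℝ) (y : Fin q → Fin m → ℝ) : ℝ :=
  9 * κ ^ 2 * μ ^ 2 * (1 / ((m : ℝ) * q)) * ∑ k, ∑ i, y k i ^ 2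

/-- Zero out the entries of `y` of magnitude larger than `√α`. -/
def trunc {m : ℕ} (α : ℝ) (y : Fin m → ℝ) : Fin m → ℝ :=
  fun i => if |y i| ≤ √α then y i else 0

/-- `X̂₀ = (1/m) ∑_k A_kᵀ y_{k,trunc}(α) e_kᵀ`. -/
def initMatrix {n q m : ℕ} (κ μ : ℝ) (A : Fin q → Matrix (Fin m) (Fin n) ℝ)
    (y : Fin q → Fin m → ℝ) : Matrix (Fin n) (Fin q) ℝ :=
  (1 / (m : ℝ)) • ∑ k, vecMulVec ((A k)ᵀ *ᵥ trunc (truncLevel κ μ y) (y k)) (Pi.single k 1)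

/-- The random measurement model: the entries of all `A_k` are standard Gaussian, the entries of
all noise vectors `v_k` are Gaussian with mean `0` and variance `σ²`, and all of these
random variables are mutually independent. -/
structure IsGaussianModel {Ω : Type*} [MeasurableSpace Ω] (P : Measure Ω) {n q m : ℕ} (σ : ℝ≥0)
    (A : Fin q → Ω → Matrix (Fin m) (Fin n) ℝ) (v : Fin q → Ω → Fin m → ℝ) : Prop where
  law_A : ∀ k i j, HasLaw (fun ω => A k ω i j) (gaussianReal 0 1) P
  law_v : ∀ k i, HasLaw (fun ω => v k ω i) (gaussianReal 0 (σ ^ 2)) P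
  indep : iIndepFun (fun (a : (Fin q × Fin m × Fin n) ⊕ (Fin q × Fin m)) (ω : Ω) =>
    Sum.elim (fun t => A t.1 ω t.2.1 t.2.2) (fun t => v t.1 ω t.2) a) P

end LRCS

end

/-! The proof conditions on all the measurements at once. Regressing a sensing row `a` of column `k`
on its own measurement gives `a = (y / Var y) x_k + residual`. Everything is jointly Gaussian, so
the residuals are independent of the whole vector of measurements, hence also of the data-dependent
truncation level. Substitution gives the exact identity `X̂₀ = X* D + G` (`initMatrix_eq`): `D` is
diagonal and depends on `y` only, while `G` is linear in the residuals with coefficients that are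
functions of `y`. No comparison with an expectation and no sandwiching of the random level is
needed.

For every `D` the signal `X* D = U* (Σ V*ᵀ D)` has columns in the span of `U*`. The sin Θ bound
`SD₂_le_of_perturbation` therefore needs only a lower bound on `D V* Σ` and an upper bound on `‖G‖`.

Signal: for `p = V* Σ u`, Cauchy–Schwarz gives `pᵀ D p ≤ ‖p‖ ‖D p‖`, so a lower bound on the
quadratic form is enough. Once the truncation level exceeds every column variance, `4 D_k` dominates
the fraction of measurements of column `k` lying between half a standard deviation and one
(`midFraction_le_signalWeight`). These fractions have mean at least 1/10; Chernoff, incoherence (no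
single row of `V*` dominates) and a net in dimension `r` finish.

Noise: given `y` with level at most `a`, each `wᵀ G z` with `w`, `z` in the unit balls is a centred
Gaussian of variance at most `a / m`; nets of the two balls bound `‖G‖`.

Both halves use the scale `R = κ² μ² T / q`, where `T` is the sum of the column variances.
Incoherence makes `R` an upper bound for each variance (`IsSVD.colVar_le`), and concentration of `∑
y²` within a factor 4 of its mean puts the truncation level between `R` and `36 R`. -/

namespace LRCS

/-! ### Separated sets and nets in Euclidean balls. -/

section Nets

/-- Volumetric bound on the size of a separated subset of the Euclidean unit ball. -/
theorem card_le_of_separated {d : ℕ} {ε : ℝ} (hε : 0 < ε)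
    (T : Finset (EuclideanSpace ℝ (Fin d))) (hT : ∀ x ∈ T, ‖x‖ ≤ 1)
    (hsep : ∀ x ∈ T, ∀ y ∈ T, x ≠ y → ε < dist x y) :
    (T.card : ℝ) ≤ (1 + 2 / ε) ^ d := by
  have hdisj : (T : Set (EuclideanSpace ℝ (Fin d))).PairwiseDisjoint
      (fun x => Metric.ball x (ε / 2)) := by
    intro x hx y hy hxy
    exact Metric.ball_disjoint_ball (by linarith [hsep x hx y hy hxy])
  have hsub : (⋃ x ∈ T, Metric.ball x (ε / 2)) ⊆
      Metric.ball (0 : EuclideanSpace ℝ (Fin d)) (1 + ε / 2) := by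
    intro z hz
    simp only [Set.mem_iUnion, Metric.mem_ball, exists_prop] at hz ⊢
    obtain ⟨x, hx, hzx⟩ := hz
    have h1 := hT x hx
    have h2 := dist_triangle z x 0
    rw [dist_zero_right x] at h2
    linarith
  have hvol := measure_mono (μ := volume) hsub
  rw [measure_biUnion_finset hdisj (fun x _ => measurableSet_ball)] at hvol
  have hfin : Module.finrank ℝ (EuclideanSpace ℝ (Fin d)) = d := by simp
  simp only [Measure.addHaar_ball_of_pos volume _ (half_pos hε),
    Measure.addHaar_ball_of_pos volume (0 : EuclideanSpace ℝ (Fin d)) (r := 1 + ε / 2)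
      (by positivity),
    hfin, Finset.sum_const, nsmul_eq_mul] at hvol
  rw [← mul_assoc] at hvol
  have hb0 : volume (Metric.ball (0 : EuclideanSpace ℝ (Fin d)) 1) ≠ 0 :=
    (Metric.measure_ball_pos volume _ one_pos).ne'
  have hbt : volume (Metric.ball (0 : EuclideanSpace ℝ (Fin d)) 1) ≠ ⊤ :=
    measure_ball_lt_top.ne
  rw [ENNReal.mul_le_mul_iff_left hb0 hbt, ← ENNReal.ofReal_natCast,
    ← ENNReal.ofReal_mul (by positivity), ENNReal.ofReal_le_ofReal_iff (by positivity)] at hvol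
  have h3 : (1 + 2 / ε) ^ d * (ε / 2) ^ d = (1 + ε / 2) ^ d := by
    rw [← mul_pow]; congr 1; field_simp; ring
  rw [← h3] at hvol
  exact le_of_mul_le_mul_right hvol (by positivity)

/-- Every subset of the Euclidean unit ball has an `ε`-net with at most `(1 + 2 / ε) ^ d`
elements. -/
theorem exists_net {d : ℕ} {ε : ℝ} (hε : 0 < ε) (s : Set (EuclideanSpace ℝ (Fin d)))
    (hs : ∀ x ∈ s, ‖x‖ ≤ 1) :
    ∃ T : Finset (EuclideanSpace ℝ (Fin d)), (∀ x ∈ T, x ∈ s) ∧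
      (∀ x ∈ s, ∃ y ∈ T, dist x y ≤ ε) ∧ (T.card : ℝ) ≤ (1 + 2 / ε) ^ d := by
  classical
  let K : Set ℕ := {k | ∃ T : Finset (EuclideanSpace ℝ (Fin d)), (∀ x ∈ T, x ∈ s) ∧
    (∀ x ∈ T, ∀ y ∈ T, x ≠ y → ε < dist x y) ∧ T.card = k}
  have hK : K.Nonempty := ⟨0, ∅, by simp⟩
  have hbd : BddAbove K := by
    refine ⟨⌊(1 + 2 / ε) ^ d⌋₊, ?_⟩
    rintro k ⟨T, h1, h2, rfl⟩
    exact Nat.le_floor (card_le_of_separated hε T (fun x hx => hs x (h1 x hx)) h2)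
  -- A separated subset of maximal cardinality is a net: an uncovered point could be added to it.
  obtain ⟨T, h1, h2, h3⟩ := Nat.sSup_mem hK hbd
  refine ⟨T, h1, ?_, card_le_of_separated hε T (fun x hx => hs x (h1 x hx)) h2⟩
  intro x hx
  by_contra! hcon
  have hxT : x ∉ T := fun h => by
    have := hcon x h
    rw [dist_self] at this
    linarith
  have hmem : T.card + 1 ∈ K := by
    refine ⟨insert x T, ?_, ?_, Finset.card_insert_of_notMem hxT⟩
    · intro y hy
      rcases Finset.mem_insert.1 hy with rfl | hy
      · exact hx
      · exact h1 y hy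
    · intro y hy z hz hyz
      rcases Finset.mem_insert.1 hy with hy' | hy' <;>
        rcases Finset.mem_insert.1 hz with hz' | hz'
      · exact absurd (hy'.trans hz'.symm) hyz
      · rw [hy']; exact hcon z hz'
      · rw [hz', dist_comm]; exact hcon y hy'
      · exact h2 y hy' z hz' hyz
  have := le_csSup hbd hmem
  omega

end Nets

/-! ### Operator norms and quadratic forms controlled on nets. -/

section Deterministic
open scoped Matrix.Norms.L2Operator

theorem dotProduct_eq_inner_toLp {d : ℕ} (x y : Fin d → ℝ) :
    x ⬝ᵥ y = inner ℝ (WithLp.toLp 2 x) (WithLp.toLp 2 y) := by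
  simp [PiLp.inner_apply, dotProduct, mul_comm]

theorem norm_toLp_sq {d : ℕ} (x : Fin d → ℝ) : ‖WithLp.toLp 2 x‖ ^ 2 = x ⬝ᵥ x := by
  rw [dotProduct_eq_inner_toLp, real_inner_self_eq_norm_sq]

theorem norm_toLp_mulVec_le {a b : ℕ} (M : Matrix (Fin a) (Fin b) ℝ) (x : Fin b → ℝ) :
    ‖WithLp.toLp 2 (M *ᵥ x)‖ ≤ ‖M‖ * ‖WithLp.toLp 2 x‖ :=
  Matrix.l2_opNorm_mulVec M (WithLp.toLp 2 x)

theorem l2_opNorm_le_of_unit {a b : ℕ} (M : Matrix (Fin a) (Fin b) ℝ) {K : ℝ} (hK : 0 ≤ K)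
    (h : ∀ x : Fin b → ℝ, ‖WithLp.toLp 2 (M *ᵥ x)‖ ≤ K * ‖WithLp.toLp 2 x‖) : ‖M‖ ≤ K := by
  rw [Matrix.l2_opNorm_def]
  exact ContinuousLinearMap.opNorm_le_bound _ hK (fun x => h x.ofLp)

theorem l2_opNorm_transpose_eq {a b : ℕ} (M : Matrix (Fin a) (Fin b) ℝ) : ‖Mᵀ‖ = ‖M‖ := by
  rw [← Matrix.l2_opNorm_conjTranspose M, Matrix.conjTranspose_eq_transpose_of_trivial]

theorem norm_toLp_mulVec_of_orthonormal {a b : ℕ} (U : Matrix (Fin a) (Fin b) ℝ)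
    (hU : Uᵀ * U = 1) (x : Fin b → ℝ) : ‖WithLp.toLp 2 (U *ᵥ x)‖ = ‖WithLp.toLp 2 x‖ := by
  have : ‖WithLp.toLp 2 (U *ᵥ x)‖ ^ 2 = ‖WithLp.toLp 2 x‖ ^ 2 := by
    rw [norm_toLp_sq, norm_toLp_sq, dotProduct_mulVec, vecMul_mulVec, hU, ← dotProduct_mulVec,
      one_mulVec]
  exact (sq_eq_sq₀ (norm_nonneg _) (norm_nonneg _)).1 this

/-- The operator norm is controlled by the bilinear form on a pair of `1/4`-nets. -/
theorem l2_opNorm_le_of_nets {a b : ℕ} (M : Matrix (Fin a) (Fin b) ℝ) {t : ℝ} (ht : 0 ≤ t)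
    (T₁ : Finset (EuclideanSpace ℝ (Fin a))) (T₂ : Finset (EuclideanSpace ℝ (Fin b)))
    (h₁ : ∀ x, ‖x‖ ≤ 1 → ∃ y ∈ T₁, dist x y ≤ 1 / 4)
    (h₂ : ∀ x ∈ T₂, ‖x‖ ≤ 1) (h₂' : ∀ x, ‖x‖ ≤ 1 → ∃ y ∈ T₂, dist x y ≤ 1 / 4)
    (hM : ∀ w ∈ T₁, ∀ z ∈ T₂, w.ofLp ⬝ᵥ M *ᵥ z.ofLp ≤ t) : ‖M‖ ≤ 2 * t := by
  -- Each of the two discretizations costs `‖M‖ / 4`; the total `‖M‖ / 2` is absorbed on the left at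
  -- the end.
  have key : ∀ x : EuclideanSpace ℝ (Fin b), ‖x‖ ≤ 1 →
      ‖WithLp.toLp 2 (M *ᵥ x.ofLp)‖ ≤ t + ‖M‖ / 2 := by
    intro x hx
    obtain ⟨z, hz, hxz⟩ := h₂' x hx
    set p := WithLp.toLp 2 (M *ᵥ z.ofLp) with hp
    have hMz : ‖p‖ ≤ t + ‖M‖ / 4 := by
      rcases eq_or_ne p 0 with h0 | h0
      · rw [h0, norm_zero]; positivity
      have hpn : 0 < ‖p‖ := norm_pos_iff.2 h0
      have hu : ‖(‖p‖⁻¹ • p)‖ ≤ 1 := by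
        rw [norm_smul, norm_inv, norm_norm, inv_mul_cancel₀ hpn.ne']
      obtain ⟨w, hw, hxw⟩ := h₁ _ hu
      have e1 : ‖p‖ = inner ℝ (‖p‖⁻¹ • p) p := by
        rw [inner_smul_left, real_inner_self_eq_norm_sq]
        simp
        field_simp
      have e2 : inner ℝ (‖p‖⁻¹ • p) p = inner ℝ w p + inner ℝ (‖p‖⁻¹ • p - w) p := by
        rw [← inner_add_left]; congr 1; abel
      have e3 : inner ℝ w p ≤ t := by
        have := hM w hw z hz
        rwa [dotProduct_eq_inner_toLp] at this
      have e4 : inner ℝ (‖p‖⁻¹ • p - w) p ≤ 1 / 4 * ‖M‖ := by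
        refine (real_inner_le_norm _ _).trans ?_
        rw [dist_eq_norm] at hxw
        have : ‖p‖ ≤ ‖M‖ := by
          refine (norm_toLp_mulVec_le M z.ofLp).trans ?_
          have := h₂ z hz
          exact mul_le_of_le_one_right (norm_nonneg _) this
        gcongr
      linarith
    have e5 : WithLp.toLp 2 (M *ᵥ x.ofLp) = p + WithLp.toLp 2 (M *ᵥ (x - z).ofLp) := by
      rw [hp, ← WithLp.toLp_add, WithLp.ofLp_sub, mulVec_sub]; congr 1; abel
    rw [e5]
    refine (norm_add_le _ _).trans ?_
    have e6 := norm_toLp_mulVec_le M (x - z).ofLp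
    rw [dist_eq_norm] at hxz
    have e7 : ‖M‖ * ‖WithLp.toLp 2 (x - z).ofLp‖ ≤ ‖M‖ * (1 / 4) := by
      gcongr
    linarith
  have : ‖M‖ ≤ t + ‖M‖ / 2 := by
    refine l2_opNorm_le_of_unit M (by positivity) (fun x => ?_)
    rcases eq_or_ne (WithLp.toLp 2 x) 0 with h0 | h0
    · have := norm_toLp_mulVec_le M x
      rw [h0, norm_zero, mul_zero] at this ⊢
      exact this
    have hpn : 0 < ‖WithLp.toLp 2 x‖ := norm_pos_iff.2 h0
    have := key (‖WithLp.toLp 2 x‖⁻¹ • WithLp.toLp 2 x) (by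
      rw [norm_smul, norm_inv, norm_norm, inv_mul_cancel₀ hpn.ne'])
    rw [WithLp.ofLp_smul, mulVec_smul, WithLp.toLp_smul, norm_smul, norm_inv, norm_norm,
      inv_mul_le_iff₀ hpn] at this
    linarith
  linarith

/-- A lower bound on a quadratic form `h ↦ ∑ d k * (V h)_k ^ 2` passes from a net to the whole
sphere. -/
theorem quadratic_lower_bound_of_net {q r : ℕ} (V : Matrix (Fin q) (Fin r) ℝ) (hV : Vᵀ * V = 1)
    (d : Fin q → ℝ) (hd0 : ∀ k, 0 ≤ d k) (hd1 : ∀ k, d k ≤ 1)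
    (T : Finset (EuclideanSpace ℝ (Fin r)))
    (hT' : ∀ x, ‖x‖ = 1 → ∃ y ∈ T, dist x y ≤ 1 / 16)
    (h : ∀ x ∈ T, 1 / 40 ≤ ∑ k, d k * (V *ᵥ x.ofLp) k ^ 2) (x : Fin r → ℝ) :
    1 / 256 * ‖WithLp.toLp 2 x‖ ^ 2 ≤ ∑ k, d k * (V *ᵥ x) k ^ 2 := by
  set W : Matrix (Fin q) (Fin r) ℝ := diagonal (fun k => √(d k)) * V with hW
  have hWsq : ∀ x : Fin r → ℝ, ‖WithLp.toLp 2 (W *ᵥ x)‖ ^ 2 = ∑ k, d k * (V *ᵥ x) k ^ 2 := by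
    intro x
    rw [norm_toLp_sq, hW, ← mulVec_mulVec]
    simp only [dotProduct, mulVec_diagonal]
    refine Finset.sum_congr rfl fun k _ => ?_
    have := Real.mul_self_sqrt (hd0 k)
    linear_combination (V *ᵥ x) k ^ 2 * this
  have hWle : ∀ x : Fin r → ℝ, ‖WithLp.toLp 2 (W *ᵥ x)‖ ≤ ‖WithLp.toLp 2 x‖ := by
    intro x
    rw [← norm_toLp_mulVec_of_orthonormal V hV x]
    refine (sq_le_sq₀ (norm_nonneg _) (norm_nonneg _)).1 ?_
    rw [hWsq, norm_toLp_sq, dotProduct]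
    refine Finset.sum_le_sum fun k _ => ?_
    nlinarith [hd1 k, sq_nonneg ((V *ᵥ x) k)]
  have hunit : ∀ x : EuclideanSpace ℝ (Fin r), ‖x‖ = 1 →
      1 / 16 ≤ ‖WithLp.toLp 2 (W *ᵥ x.ofLp)‖ := by
    intro x hx
    obtain ⟨y, hy, hxy⟩ := hT' x hx
    have h1 := h y hy
    rw [← hWsq] at h1
    -- `1/40 > (1/8)²`. Since `W` is a contraction, moving off the net loses at most 1/16, which
    -- leaves 1/16, whose square is 1/256.
    have h2 : 1 / 8 ≤ ‖WithLp.toLp 2 (W *ᵥ y.ofLp)‖ := by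
      by_contra! hlt
      nlinarith [norm_nonneg (WithLp.toLp 2 (W *ᵥ y.ofLp))]
    have e5 : WithLp.toLp 2 (W *ᵥ x.ofLp) =
        WithLp.toLp 2 (W *ᵥ y.ofLp) + WithLp.toLp 2 (W *ᵥ (x - y).ofLp) := by
      rw [← WithLp.toLp_add, WithLp.ofLp_sub, mulVec_sub]; congr 1; abel
    have h3 := hWle (x - y).ofLp
    rw [dist_eq_norm] at hxy
    have h4 := norm_sub_le_norm_add (WithLp.toLp 2 (W *ᵥ y.ofLp))
      (WithLp.toLp 2 (W *ᵥ (x - y).ofLp))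
    rw [e5]
    have h5 : ‖WithLp.toLp 2 (x - y).ofLp‖ ≤ 1 / 16 := hxy
    linarith
  rw [← hWsq]
  rcases eq_or_ne (WithLp.toLp 2 x) 0 with h0 | h0
  · rw [h0, norm_zero]; simp
  have hpn : 0 < ‖WithLp.toLp 2 x‖ := norm_pos_iff.2 h0
  have := hunit (‖WithLp.toLp 2 x‖⁻¹ • WithLp.toLp 2 x) (by
      rw [norm_smul, norm_inv, norm_norm, inv_mul_cancel₀ hpn.ne'])
  rw [WithLp.ofLp_smul, mulVec_smul, WithLp.toLp_smul, norm_smul, norm_inv, norm_norm,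
      le_inv_mul_iff₀ hpn] at this
  have h6 : (‖WithLp.toLp 2 x‖ * (1 / 16)) ^ 2 ≤ ‖WithLp.toLp 2 (W *ᵥ x)‖ ^ 2 := by gcongr
  linarith

end Deterministic
-- Singular values and the sin Θ bound.
section Wedin
open scoped Matrix.Norms.L2Operator

theorem l2_opNorm_le_one_of_orthonormal {a b : ℕ} (U : Matrix (Fin a) (Fin b) ℝ)
    (hU : Uᵀ * U = 1) : ‖U‖ ≤ 1 :=
  l2_opNorm_le_of_unit U zero_le_one fun x => by
    rw [norm_toLp_mulVec_of_orthonormal U hU, one_mul]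

theorem l2_opNorm_one_sub_mul_transpose_le {a b : ℕ} (U : Matrix (Fin a) (Fin b) ℝ)
    (hU : Uᵀ * U = 1) : ‖1 - U * Uᵀ‖ ≤ 1 := by
  refine l2_opNorm_le_of_unit _ zero_le_one fun x => ?_
  rw [one_mul]
  refine (sq_le_sq₀ (norm_nonneg _) (norm_nonneg _)).1 ?_
  have hsymm : (1 - U * Uᵀ)ᵀ = 1 - U * Uᵀ := by simp
  have hidem : (1 - U * Uᵀ) * (1 - U * Uᵀ) = 1 - U * Uᵀ := by
    have : U * Uᵀ * (U * Uᵀ) = U * Uᵀ := by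
      rw [Matrix.mul_assoc, ← Matrix.mul_assoc Uᵀ, hU, Matrix.one_mul]
    rw [Matrix.sub_mul, Matrix.one_mul, Matrix.mul_sub, Matrix.mul_one, this]
    simp
  rw [norm_toLp_sq, norm_toLp_sq, dotProduct_mulVec, vecMul_mulVec, hsymm, hidem,
    ← dotProduct_mulVec, sub_mulVec, one_mulVec, dotProduct_sub, ← mulVec_mulVec]
  have h1 : x ⬝ᵥ U *ᵥ (Uᵀ *ᵥ x) = ‖WithLp.toLp 2 (Uᵀ *ᵥ x)‖ ^ 2 := by
    rw [norm_toLp_sq, dotProduct_mulVec, ← mulVec_transpose]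
  rw [h1]
  linarith [sq_nonneg ‖WithLp.toLp 2 (Uᵀ *ᵥ x)‖]

/-- Min-max lower bound: the `r`-th singular value of `X` is at least the smallest stretch of `Xᵀ`
on any `r`-dimensional subspace. -/
theorem le_singularValue_of_forall {n q r p : ℕ} (X : Matrix (Fin n) (Fin q) ℝ)
    (U : Matrix (Fin n) (Fin r) ℝ) (hU : Uᵀ * U = 1)
    (W : Matrix (Fin n) (Fin p) ℝ) (s : Fin p → ℝ) (V : Matrix (Fin q) (Fin p) ℝ)
    (hsvd : IsSVD X W s V) {γ : ℝ}
    (hγ : ∀ u : Fin r → ℝ, γ * ‖WithLp.toLp 2 u‖ ≤ ‖WithLp.toLp 2 (Xᵀ *ᵥ (U *ᵥ u))‖)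
    (i : Fin p) (hi : (i : ℕ) < r) : γ ≤ s i := by
  let M : Matrix (Fin p) (Fin r) ℝ := Wᵀ * U
  let f : (Fin r → ℝ) →ₗ[ℝ] (Fin (i : ℕ) → ℝ) :=
    (LinearMap.funLeft ℝ ℝ (Fin.castLE i.2.le)) ∘ₗ M.mulVecLin
  -- Dimension count: fewer than `r` linear conditions make `U u` orthogonal to the singular vectors
  -- before the `i`-th, so `Xᵀ` stretches it by at most `s i`.
  have hker : LinearMap.ker f ≠ ⊥ := LinearMap.ker_ne_bot_of_finrank_lt (by simpa using hi)
  obtain ⟨u, hu, hu0⟩ := Submodule.exists_mem_ne_zero_of_ne_bot hker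
  have hzero : ∀ j : Fin p, j < i → (M *ᵥ u) j = 0 := by
    intro j hj
    exact congrFun (LinearMap.mem_ker.1 hu) ⟨j, hj⟩
  have hun : 0 < ‖WithLp.toLp 2 u‖ := norm_pos_iff.2 (by simpa using hu0)
  have h1 : Xᵀ *ᵥ (U *ᵥ u) = V *ᵥ (diagonal s *ᵥ (M *ᵥ u)) := by
    rw [hsvd.eq]
    simp only [M, transpose_mul, transpose_transpose, diagonal_transpose, mulVec_mulVec,
      Matrix.mul_assoc]
  have h2 : ‖WithLp.toLp 2 (Xᵀ *ᵥ (U *ᵥ u))‖ ≤ s i * ‖WithLp.toLp 2 u‖ := by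
    rw [h1, norm_toLp_mulVec_of_orthonormal V hsvd.right_orthonormal]
    have h3 : ‖WithLp.toLp 2 (M *ᵥ u)‖ ≤ ‖WithLp.toLp 2 u‖ := by
      have h4 := norm_toLp_mulVec_le Wᵀ (U *ᵥ u)
      rw [norm_toLp_mulVec_of_orthonormal U hU, l2_opNorm_transpose_eq, mulVec_mulVec] at h4
      refine h4.trans (mul_le_of_le_one_left (norm_nonneg _)
        (l2_opNorm_le_one_of_orthonormal W hsvd.left_orthonormal))
    have h5 : ‖WithLp.toLp 2 (diagonal s *ᵥ (M *ᵥ u))‖ ≤ s i * ‖WithLp.toLp 2 (M *ᵥ u)‖ := by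
      refine (sq_le_sq₀ (norm_nonneg _) (mul_nonneg (hsvd.nonneg i) (norm_nonneg _))).1 ?_
      rw [mul_pow, norm_toLp_sq, norm_toLp_sq, dotProduct, dotProduct, Finset.mul_sum]
      refine Finset.sum_le_sum fun j _ => ?_
      rw [mulVec_diagonal]
      rcases lt_or_ge j i with hj | hj
      · rw [hzero j hj]; simp
      · have := hsvd.antitone hj
        have h6 : s j ^ 2 ≤ s i ^ 2 := by
          have := hsvd.nonneg j
          gcongr
        nlinarith [mul_self_nonneg ((M *ᵥ u) j)]
    exact h5.trans (mul_le_mul_of_nonneg_left h3 (hsvd.nonneg i))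
  exact le_of_mul_le_mul_right ((hγ u).trans h2) hun

/-- A `sin Θ` bound for a perturbation of a matrix with column space spanned by `U`. -/
theorem SD₂_le_of_perturbation {n q r : ℕ} (U : Matrix (Fin n) (Fin r) ℝ)
    (hU : Uᵀ * U = 1) (B : Matrix (Fin r) (Fin q) ℝ) (G X : Matrix (Fin n) (Fin q) ℝ)
    (hX : X = U * B + G) {γ η : ℝ}
    (hγ : ∀ u : Fin r → ℝ, γ * ‖WithLp.toLp 2 u‖ ≤ ‖WithLp.toLp 2 (Bᵀ *ᵥ u)‖)
    (hη : ‖G‖ ≤ η) (hηγ : η < γ) (U₀ : Matrix (Fin n) (Fin r) ℝ)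
    (hU₀ : IsTopLeftSingularVectors X U₀) : SD₂ U U₀ ≤ η / (γ - η) := by
  obtain ⟨W, s, V, h, hsvd, hUW⟩ := hU₀
  have hη0 : 0 ≤ η := (norm_nonneg _).trans hη
  have hpos : 0 < γ - η := sub_pos.2 hηγ
  -- Weyl's inequality: the perturbation lowers the top `r` singular values by at most `η`.
  have hlow : ∀ j : Fin r, γ - η ≤ s (Fin.castLE h j) := by
    intro j
    refine le_singularValue_of_forall X U hU W s V hsvd (fun u => ?_) _ j.2
    have e : Xᵀ *ᵥ (U *ᵥ u) = Bᵀ *ᵥ u + Gᵀ *ᵥ (U *ᵥ u) := by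
      rw [hX, transpose_add, transpose_mul, add_mulVec, mulVec_mulVec, Matrix.mul_assoc, hU,
        Matrix.mul_one]
    have e1 := norm_toLp_mulVec_le Gᵀ (U *ᵥ u)
    rw [l2_opNorm_transpose_eq, norm_toLp_mulVec_of_orthonormal U hU] at e1
    have e2 : ‖G‖ * ‖WithLp.toLp 2 u‖ ≤ η * ‖WithLp.toLp 2 u‖ := by gcongr
    rw [e, WithLp.toLp_add]
    have e3 := norm_sub_le_norm_add (WithLp.toLp 2 (Bᵀ *ᵥ u)) (WithLp.toLp 2 (Gᵀ *ᵥ (U *ᵥ u)))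
    have e4 := hγ u
    linarith
  set V₀ : Matrix (Fin q) (Fin r) ℝ := V.submatrix id (Fin.castLE h) with hV₀
  have hV₀o : V₀ᵀ * V₀ = 1 := by
    have : V₀ᵀ * V₀ = (Vᵀ * V).submatrix (Fin.castLE h) (Fin.castLE h) := by
      ext i j; simp [hV₀, Matrix.mul_apply]
    rw [this, hsvd.right_orthonormal]
    exact Matrix.submatrix_one _ (Fin.castLE_injective h)
  set D : Matrix (Fin r) (Fin r) ℝ := diagonal fun j => (s (Fin.castLE h j))⁻¹ with hD
  -- Writing `U₀` as the image of `V₀` under `X` lets the projection `1 - U Uᵀ` annihilate the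
  -- signal and leave only `G`.
  have hU₀eq : U₀ = X * V₀ * D := by
    have hXV : X * V = W * diagonal s := by
      rw [hsvd.eq, Matrix.mul_assoc, hsvd.right_orthonormal, Matrix.mul_one]
    have hXV₀ : X * V₀ = (X * V).submatrix id (Fin.castLE h) := by
      ext i j; simp [hV₀, Matrix.mul_apply]
    ext i j
    have hne : s (Fin.castLE h j) ≠ 0 := (hpos.trans_le (hlow j)).ne'
    rw [hXV₀, hXV, hD, Matrix.mul_diagonal, Matrix.submatrix_apply, Matrix.mul_diagonal, hUW]
    simp [hne]
  have hproj : (1 - U * Uᵀ) * U₀ = (1 - U * Uᵀ) * G * V₀ * D := by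
    have : (1 - U * Uᵀ) * X = (1 - U * Uᵀ) * G := by
      have h0 : (1 - U * Uᵀ) * U = 0 := by
        rw [Matrix.sub_mul, Matrix.one_mul, Matrix.mul_assoc, hU, Matrix.mul_one, sub_self]
      rw [hX, Matrix.mul_add, ← Matrix.mul_assoc, h0, Matrix.zero_mul, zero_add]
    rw [hU₀eq, ← Matrix.mul_assoc, ← Matrix.mul_assoc, this]
  have hDn : ‖D‖ ≤ (γ - η)⁻¹ := by
    rw [hD, Matrix.l2_opNorm_diagonal]
    refine (pi_norm_le_iff_of_nonneg (inv_nonneg.2 hpos.le)).2 fun j => ?_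
    rw [Real.norm_of_nonneg (inv_nonneg.2 (hsvd.nonneg _))]
    exact inv_anti₀ hpos (hlow j)
  unfold SD₂
  rw [hproj, div_eq_mul_inv]
  refine (Matrix.l2_opNorm_mul _ _).trans ?_
  refine mul_le_mul ?_ hDn (norm_nonneg _) hη0
  refine (Matrix.l2_opNorm_mul _ _).trans ?_
  have a1 := l2_opNorm_le_one_of_orthonormal V₀ hV₀o
  have a2 : ‖(1 - U * Uᵀ) * G‖ ≤ η := by
    refine (Matrix.l2_opNorm_mul _ _).trans ?_
    have := l2_opNorm_one_sub_mul_transpose_le U hU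
    calc ‖1 - U * Uᵀ‖ * ‖G‖ ≤ 1 * η := by gcongr
      _ = η := one_mul _
  calc ‖(1 - U * Uᵀ) * G‖ * ‖V₀‖ ≤ η * 1 := by gcongr
    _ = η := mul_one _

end Wedin
-- Chernoff bounds, unconditional and conditional.
section Chernoff
variable {Ω : Type*} [MeasurableSpace Ω] {P : Measure Ω} {J : Type*} [Fintype J]

/-- `HasLaw` supplies only a.e. measurability, so the product formula is applied to measurable
modifications. Lower integrals avoid integrability conditions. -/
theorem lintegral_prod_comp_of_iIndepFun {Z : J → Ω → ℝ} (hZ : iIndepFun Z P)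
    (hm : ∀ j, AEMeasurable (Z j) P) (f : J → ℝ → ENNReal) (hf : ∀ j, Measurable (f j)) :
    ∫⁻ ω, ∏ j, f j (Z j ω) ∂P = ∏ j, ∫⁻ x, f j x ∂(P.map (Z j)) := by
  have h1 : iIndepFun (fun j ω => f j ((hm j).mk (Z j) ω)) P :=
    (hZ.congr fun j => (hm j).ae_eq_mk).comp f hf
  have h2 := lintegral_prod_eq_prod_lintegral_of_indepFun Finset.univ _ h1
    (fun j => (hf j).comp (hm j).measurable_mk)
  have h3 : ∀ᵐ ω ∂P, ∀ j, Z j ω = (hm j).mk (Z j) ω := ae_all_iff.2 fun j => (hm j).ae_eq_mk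
  rw [lintegral_congr_ae (h3.mono fun ω hω => Finset.prod_congr rfl fun j _ => by rw [hω j]), h2]
  refine Finset.prod_congr rfl fun j _ => ?_
  rw [lintegral_map' (hf j).aemeasurable (hm j)]
  exact lintegral_congr_ae ((hm j).ae_eq_mk.mono fun ω hω => by simp only [hω])

/-- Chernoff bound for sums of functions of independent variables. -/
theorem measure_sum_ge_le {Z : J → Ω → ℝ} (hZ : iIndepFun Z P)
    (hm : ∀ j, AEMeasurable (Z j) P) (φ : J → ℝ → ℝ) (hφ : ∀ j, Measurable (φ j)) (a : J → ℝ)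
    (h : ∀ j, ∫⁻ x, ENNReal.ofReal (Real.exp (φ j x)) ∂(P.map (Z j)) ≤
      ENNReal.ofReal (Real.exp (a j))) (t : ℝ) :
    P {ω | t ≤ ∑ j, φ j (Z j ω)} ≤ ENNReal.ofReal (Real.exp (∑ j, a j - t)) := by
  have hmeas : ∀ j, Measurable fun x => ENNReal.ofReal (Real.exp (φ j x)) :=
    fun j => (Real.measurable_exp.comp (hφ j)).ennreal_ofReal
  have h1 := lintegral_prod_comp_of_iIndepFun hZ hm _ hmeas
  have hae : AEMeasurable (fun ω => ∏ j, ENNReal.ofReal (Real.exp (φ j (Z j ω)))) P :=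
    Finset.aemeasurable_fun_prod _ fun j _ => (hmeas j).comp_aemeasurable (hm j)
  have h2 := mul_meas_ge_le_lintegral₀ hae (ENNReal.ofReal (Real.exp t))
  have h3 : {ω | t ≤ ∑ j, φ j (Z j ω)} =
      {ω | ENNReal.ofReal (Real.exp t) ≤ ∏ j, ENNReal.ofReal (Real.exp (φ j (Z j ω)))} := by
    ext ω
    simp only [Set.mem_ofPred_eq]
    rw [← ENNReal.ofReal_prod_of_nonneg fun j _ => (Real.exp_pos _).le, ← Real.exp_sum,
      ENNReal.ofReal_le_ofReal_iff (Real.exp_pos _).le, Real.exp_le_exp]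
  rw [← h3, h1] at h2
  have h4 : ∏ j, ∫⁻ x, ENNReal.ofReal (Real.exp (φ j x)) ∂(P.map (Z j)) ≤
      ENNReal.ofReal (Real.exp (∑ j, a j)) := by
    rw [Real.exp_sum, ENNReal.ofReal_prod_of_nonneg fun j _ => (Real.exp_pos _).le]
    exact Finset.prod_le_prod' fun j _ => h j
  have h5 := h2.trans h4
  rw [Real.exp_sub, ENNReal.ofReal_div_of_pos (Real.exp_pos _),
    ENNReal.le_div_iff_mul_le (Or.inl (by simp [Real.exp_pos])) (Or.inl ENNReal.ofReal_ne_top),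
    mul_comm]
  exact h5

theorem lintegral_exp_mul_gaussianReal (v : ℝ≥0) (c : ℝ) :
    ∫⁻ x, ENNReal.ofReal (Real.exp (c * x)) ∂(gaussianReal 0 v) =
      ENNReal.ofReal (Real.exp (v * c ^ 2 / 2)) := by
  rw [← ofReal_integral_eq_lintegral_ofReal (integrable_exp_mul_gaussianReal c)
    (ae_of_all _ fun x => (Real.exp_pos _).le)]
  have := congrFun (mgf_id_gaussianReal (μ := 0) (v := v)) c
  simp only [mgf, id] at this
  rw [this, zero_mul, zero_add]

/-- A tail bound for Gaussian sums with random coefficients independent of the Gaussians. -/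
theorem measure_sum_mul_ge_le [IsProbabilityMeasure P] {Y H : J → Ω → ℝ}
    (hY : ∀ j, AEMeasurable (Y j) P)
    (hYH : IndepFun (fun ω j => Y j ω) (fun ω j => H j ω) P) (hH : iIndepFun H P)
    (v : J → ℝ≥0) (hv : ∀ j, v j ≤ 1) (hlaw : ∀ j, HasLaw (H j) (gaussianReal 0 (v j)) P)
    (S : Set (J → ℝ)) (hS : MeasurableSet S) (c : (J → ℝ) → J → ℝ) (hc : Measurable c)
    {K t : ℝ} (hK : 0 < K) (ht : 0 ≤ t) (hcK : ∀ y ∈ S, ∑ j, c y j ^ 2 ≤ K) :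
    P {ω | (fun j => Y j ω) ∈ S ∧ t ≤ ∑ j, c (fun j => Y j ω) j * H j ω} ≤
      ENNReal.ofReal (Real.exp (-(t ^ 2 / (2 * K)))) := by
  have hHm : ∀ j, AEMeasurable (H j) P := fun j => (hlaw j).aemeasurable
  have hYm : AEMeasurable (fun ω j => Y j ω) P := aemeasurable_pi_lambda _ hY
  have hHm' : AEMeasurable (fun ω j => H j ω) P := aemeasurable_pi_lambda _ hHm
  let A : Set ((J → ℝ) × (J → ℝ)) := {p | p.1 ∈ S ∧ t ≤ ∑ j, c p.1 j * p.2 j}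
  have hA : MeasurableSet A := by
    have h0 : MeasurableSet {p : (J → ℝ) × (J → ℝ) | t ≤ ∑ j, c p.1 j * p.2 j} := by
      refine measurableSet_le measurable_const ?_
      refine Finset.measurable_fun_sum _ fun j _ => ?_
      exact ((measurable_pi_apply j).comp (hc.comp measurable_fst)).mul
        ((measurable_pi_apply j).comp measurable_snd)
    exact (measurable_fst hS).inter h0
  have h1 : P {ω | (fun j => Y j ω) ∈ S ∧ t ≤ ∑ j, c (fun j => Y j ω) j * H j ω} =
      P.map (fun ω => (fun j => Y j ω, fun j => H j ω)) A := by
    rw [Measure.map_apply_of_aemeasurable (hYm.prodMk hHm') hA]; rfl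
  have : IsProbabilityMeasure (P.map fun ω j => Y j ω) := Measure.isProbabilityMeasure_map hYm
  have : IsProbabilityMeasure (P.map fun ω j => H j ω) := Measure.isProbabilityMeasure_map hHm'
  -- Independence makes the joint law a product, so the coefficients can be frozen at a fixed `y`.
  rw [h1, (indepFun_iff_map_prod_eq_prod_map_map hYm hHm').1 hYH, Measure.prod_apply hA]
  have h2 : ∀ y, (P.map fun ω j => H j ω) (Prod.mk y ⁻¹' A) ≤
      ENNReal.ofReal (Real.exp (-(t ^ 2 / (2 * K)))) := by
    intro y
    by_cases hy : y ∈ S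
    · rw [Measure.map_apply_of_aemeasurable hHm' (measurable_prodMk_left hA)]
      -- The tilt `t / K` minimizes `λ² K / 2 - λ t`.
      have h3 := measure_sum_ge_le hH hHm (fun j x => t / K * c y j * x)
        (fun j => measurable_const.mul measurable_id)
        (fun j => (v j : ℝ) * (t / K * c y j) ^ 2 / 2)
        (fun j => by rw [(hlaw j).map_eq, lintegral_exp_mul_gaussianReal]) (t / K * t)
      have h4 : (fun ω j => H j ω) ⁻¹' (Prod.mk y ⁻¹' A) ⊆
          {ω | t / K * t ≤ ∑ j, t / K * c y j * H j ω} := by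
        intro ω hω
        have h5 : t ≤ ∑ j, c y j * H j ω := hω.2
        simp only [Set.mem_ofPred_eq, mul_assoc, ← Finset.mul_sum]
        exact mul_le_mul_of_nonneg_left h5 (by positivity)
      refine (measure_mono h4).trans (h3.trans (ENNReal.ofReal_le_ofReal (Real.exp_le_exp.2 ?_)))
      have h6 : ∑ j, (v j : ℝ) * (t / K * c y j) ^ 2 / 2 ≤ (t / K) ^ 2 / 2 * K := by
        refine le_trans ?_ (mul_le_mul_of_nonneg_left (hcK y hy) (by positivity))
        rw [Finset.mul_sum]
        refine Finset.sum_le_sum fun j _ => ?_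
        have h7 : (v j : ℝ) ≤ 1 := by exact_mod_cast hv j
        nlinarith [sq_nonneg (t / K * c y j)]
      have h8 : (t / K) ^ 2 / 2 * K - t / K * t = -(t ^ 2 / (2 * K)) := by
        field_simp
        ring
      linarith
    · have : Prod.mk y ⁻¹' A = ∅ := by
        ext h
        simp [A, hy]
      rw [this, measure_empty]
      exact zero_le
  refine (lintegral_mono h2).trans ?_
  rw [lintegral_const, measure_univ, mul_one]

end Chernoff

/-! ### Exponential moments and small intervals for one Gaussian. -/

section GaussianMoments

theorem lintegral_exp_mul_sq_gaussianReal {v : ℝ≥0} (hv : v ≠ 0) {b : ℝ} (hb : 2 * b * v < 1) :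
    ∫⁻ x, ENNReal.ofReal (Real.exp (b * x ^ 2)) ∂(gaussianReal 0 v) =
      ENNReal.ofReal (√(1 - 2 * b * v)⁻¹) := by
  have hv' : (0 : ℝ) < v := by positivity
  have hβ : 0 < 1 / (2 * (v : ℝ)) - b := by
    rw [sub_pos, lt_div_iff₀ (by positivity)]; linarith
  rw [gaussianReal_of_var_ne_zero _ hv,
    lintegral_withDensity_eq_lintegral_mul _ (measurable_gaussianPDF 0 v) (by fun_prop)]
  have h1 : ∀ x, (gaussianPDF 0 v * fun x => ENNReal.ofReal (Real.exp (b * x ^ 2))) x =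
      ENNReal.ofReal ((√(2 * Real.pi * v))⁻¹ * Real.exp (-(1 / (2 * (v : ℝ)) - b) * x ^ 2)) := by
    intro x
    rw [Pi.mul_apply, gaussianPDF, ← ENNReal.ofReal_mul (gaussianPDFReal_nonneg _ _ _),
      gaussianPDFReal_def]
    simp only []
    rw [mul_assoc, ← Real.exp_add]
    congr 3
    field_simp
    ring
  simp_rw [h1]
  rw [← ofReal_integral_eq_lintegral_ofReal ((integrable_exp_neg_mul_sq hβ).const_mul _)
    (ae_of_all _ fun x => by positivity), integral_const_mul, integral_gaussian]
  congr 1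
  rw [← Real.sqrt_inv, ← Real.sqrt_mul (by positivity)]
  congr 1
  have : 1 - 2 * b * v ≠ 0 := by linarith
  have h2 : 1 / (2 * (v : ℝ)) - b = (1 - 2 * b * v) / (2 * v) := by field_simp
  rw [h2]
  field_simp

/-- With `θ = v / (2R) ≤ 1/2` the integral is `(1 - θ)^(-1/2)`, and `(1 - θ)⁻¹ ≤ 1 + 2θ ≤ exp (2θ)`.
The tilt depends on `R` alone, so it serves columns of different variances. -/
theorem lintegral_exp_sq_div_le {v : ℝ≥0} {R : ℝ} (hR : 0 < R) (hv : (v : ℝ) ≤ R) :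
    ∫⁻ x, ENNReal.ofReal (Real.exp (x ^ 2 / (4 * R))) ∂(gaussianReal 0 v) ≤
      ENNReal.ofReal (Real.exp (v / (2 * R))) := by
  rcases eq_or_ne v 0 with rfl | h0
  · simp
  have hθ : (v : ℝ) / (2 * R) ≤ 1 / 2 := by
    rw [div_le_div_iff₀ (by positivity) (by norm_num)]; linarith
  have hθ0 : 0 ≤ (v : ℝ) / (2 * R) := by positivity
  have e : 2 * (1 / (4 * R)) * v = v / (2 * R) := by field_simp; ring
  have := lintegral_exp_mul_sq_gaussianReal h0 (b := 1 / (4 * R)) (by rw [e]; linarith)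
  rw [e] at this
  set θ := (v : ℝ) / (2 * R)
  have h1 : ∀ x : ℝ, x ^ 2 / (4 * R) = 1 / (4 * R) * x ^ 2 := fun x => by ring
  simp_rw [h1]
  rw [this]
  refine ENNReal.ofReal_le_ofReal ?_
  refine Real.sqrt_le_iff.2 ⟨(Real.exp_pos _).le, ?_⟩
  rw [← Real.exp_nat_mul]
  have h2 : (1 - θ)⁻¹ ≤ 1 + 2 * θ := by
    rw [inv_le_iff_one_le_mul₀ (by linarith)]; nlinarith
  have h3 := Real.add_one_le_exp (((2 : ℕ) : ℝ) * θ)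
  push_cast at h3 ⊢
  linarith

/-- The lower-tail counterpart: with `θ = v / R ≤ 1`, `(1 + θ)⁻¹ ≤ 1 - θ / 2 ≤ exp (-θ / 2)`. -/
theorem lintegral_exp_neg_sq_div_le {v : ℝ≥0} {R : ℝ} (hR : 0 < R) (hv : (v : ℝ) ≤ R) :
    ∫⁻ x, ENNReal.ofReal (Real.exp (-x ^ 2 / (2 * R))) ∂(gaussianReal 0 v) ≤
      ENNReal.ofReal (Real.exp (-v / (4 * R))) := by
  rcases eq_or_ne v 0 with rfl | h0
  · simp
  have hθ : (v : ℝ) / R ≤ 1 := (div_le_one hR).2 hv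
  have hθ0 : 0 ≤ (v : ℝ) / R := by positivity
  have e : 2 * (-1 / (2 * R)) * v = - (v / R) := by field_simp
  have := lintegral_exp_mul_sq_gaussianReal h0 (b := -1 / (2 * R)) (by rw [e]; linarith)
  rw [e] at this
  have e2 : -(v : ℝ) / (4 * R) = - (v / R) / 4 := by field_simp
  rw [e2]
  set θ := (v : ℝ) / R
  have h1 : ∀ x : ℝ, -x ^ 2 / (2 * R) = -1 / (2 * R) * x ^ 2 := fun x => by ring
  simp_rw [h1]
  rw [this]
  refine ENNReal.ofReal_le_ofReal ?_
  refine Real.sqrt_le_iff.2 ⟨(Real.exp_pos _).le, ?_⟩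
  rw [← Real.exp_nat_mul]
  have h2 : (1 - -θ)⁻¹ ≤ 1 - θ / 2 := by
    rw [inv_le_iff_one_le_mul₀ (by linarith)]; nlinarith
  have h3 := Real.add_one_le_exp (((2 : ℕ) : ℝ) * (-θ / 4))
  push_cast at h3 ⊢
  linarith

/-- On this interval of length `√v / 2` the density is at least its value at `√v`, which exceeds `1
/ (5 √v)` because `√(2πe) ≤ 5`. -/
theorem one_div_ten_le_gaussianReal_Icc {v : ℝ≥0} (hv : v ≠ 0) :
    ENNReal.ofReal (1 / 10) ≤ gaussianReal 0 v (Set.Icc (√v / 2) (√v)) := by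
  have hv' : (0 : ℝ) < v := by positivity
  rw [gaussianReal_apply _ hv]
  have h1 : ∀ x ∈ Set.Icc (√(v : ℝ) / 2) (√v),
      ENNReal.ofReal ((5 * √(v : ℝ))⁻¹) ≤ gaussianPDF 0 v x := by
    intro x hx
    refine ENNReal.ofReal_le_ofReal ?_
    rw [gaussianPDFReal_def]
    simp only [sub_zero]
    have hx0 : 0 ≤ x := le_trans (by positivity) hx.1
    have hx2 : x ^ 2 ≤ v := by
      have := pow_le_pow_left₀ hx0 hx.2 2
      rwa [Real.sq_sqrt hv'.le] at this
    have h2 : Real.exp (-1 / 2) ≤ Real.exp (-x ^ 2 / (2 * v)) := by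
      rw [Real.exp_le_exp, div_le_div_iff₀ (by norm_num) (by positivity)]
      nlinarith
    refine le_trans ?_ (mul_le_mul_of_nonneg_left h2 (by positivity))
    rw [Real.sqrt_mul (by positivity), mul_inv, mul_inv, mul_right_comm]
    refine mul_le_mul_of_nonneg_right ?_ (by positivity)
    have h3 : √(2 * Real.pi) * Real.exp (1 / 2) ≤ 5 := by
      have e1 : Real.exp (1 / 2) = √(Real.exp 1) := by rw [Real.exp_half]
      rw [e1, ← Real.sqrt_mul (by positivity)]
      refine Real.sqrt_le_iff.2 ⟨by norm_num, ?_⟩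
      have := Real.pi_lt_d2
      have := Real.exp_one_lt_d9
      have := Real.pi_pos
      have := Real.exp_pos 1
      nlinarith
    have h4 : (√(2 * Real.pi))⁻¹ * Real.exp (-1 / 2) =
        (√(2 * Real.pi) * Real.exp (1 / 2))⁻¹ := by
      rw [mul_inv, ← Real.exp_neg]; congr 2; norm_num
    rw [h4]
    exact inv_anti₀ (by positivity) h3
  refine le_trans ?_ (setLIntegral_mono' measurableSet_Icc h1)
  rw [setLIntegral_const, Real.volume_Icc, ← ENNReal.ofReal_mul (by positivity)]
  refine ENNReal.ofReal_le_ofReal (le_of_eq ?_)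
  have : √(v : ℝ) ≠ 0 := by positivity
  field_simp
  norm_num

/-- The integral is `1 - p (1 - exp (-l))` with `p ≥ 1/10`, and `1 - exp (-l) ≥ l / 2` on `[0, 1]`.
-/
theorem lintegral_exp_neg_indicator_le {v : ℝ≥0} (hv : v ≠ 0) {l : ℝ} (h0 : 0 ≤ l) (h1 : l ≤ 1) :
    ∫⁻ x, ENNReal.ofReal (Real.exp (-(l * (Set.Icc (√(v : ℝ) / 2) (√v)).indicator 1 x)))
      ∂(gaussianReal 0 v) ≤ ENNReal.ofReal (Real.exp (-(l / 20))) := by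
  set I := Set.Icc (√(v : ℝ) / 2) (√v)
  set p := (gaussianReal 0 v).real I with hp
  have hp1 : 1 / 10 ≤ p := by
    have := one_div_ten_le_gaussianReal_Icc hv
    rw [ENNReal.ofReal_le_iff_le_toReal (measure_ne_top _ _)] at this
    exact this
  have hI : MeasurableSet I := measurableSet_Icc
  have e : ∀ x, Real.exp (-(l * I.indicator 1 x)) =
      1 - I.indicator (fun _ => 1 - Real.exp (-l)) x := by
    intro x
    by_cases hx : x ∈ I <;> simp [hx]
  have hint : Integrable (fun x => 1 - I.indicator (fun _ => 1 - Real.exp (-l)) x)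
      (gaussianReal 0 v) :=
    (integrable_const 1).sub ((integrable_const _).indicator hI)
  simp_rw [e]
  rw [← ofReal_integral_eq_lintegral_ofReal hint
    (ae_of_all _ fun x => (Real.exp_pos _).le.trans_eq (e x)),
    integral_sub (integrable_const 1) ((integrable_const _).indicator hI),
    integral_indicator_const _ hI, ← hp]
  refine ENNReal.ofReal_le_ofReal ?_
  simp only [integral_const, probReal_univ, smul_eq_mul, mul_one]
  have h2 : Real.exp (-l) ≤ 1 - l / 2 := by
    rw [Real.exp_neg, inv_le_iff_one_le_mul₀ (Real.exp_pos _)]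
    have := Real.add_one_le_exp l
    nlinarith
  have h3 := Real.add_one_le_exp (-(l / 20))
  nlinarith

end GaussianMoments
-- Linear forms in independent Gaussians.
section LinearForms
variable {Ω : Type*} [MeasurableSpace Ω] {P : Measure Ω} {I : Type*} [Fintype I]
  {Z : I → Ω → ℝ} {s : I → ℝ≥0}

theorem hasGaussianLaw_linearForms (hlaw : ∀ a, HasLaw (Z a) (gaussianReal 0 (s a)) P)
    (hind : iIndepFun Z P) {E : Type*} [NormedAddCommGroup E] [NormedSpace ℝ E]
    [MeasurableSpace E] [BorelSpace E] (L : (I → ℝ) →ₗ[ℝ] E) :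
    HasGaussianLaw (fun ω => L fun a => Z a ω) P :=
  (hind.hasGaussianLaw fun a => (hlaw a).hasGaussianLaw).map_fun (LinearMap.toContinuousLinearMap L)

theorem covariance_linearForms [IsProbabilityMeasure P]
    (hlaw : ∀ a, HasLaw (Z a) (gaussianReal 0 (s a)) P)
    (hind : iIndepFun Z P) (c d : I → ℝ) :
    cov[fun ω => ∑ a, c a * Z a ω, fun ω => ∑ a, d a * Z a ω; P] = ∑ a, c a * d a * s a := by
  classical
  have hL : ∀ a, MemLp (Z a) 2 P := fun a => (hlaw a).hasGaussianLaw.memLp_two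
  rw [covariance_fun_sum_fun_sum (fun a => (hL a).const_mul _) (fun a => (hL a).const_mul _)]
  refine Finset.sum_congr rfl fun a _ => ?_
  rw [Finset.sum_eq_single a]
  · rw [covariance_const_mul_left, covariance_const_mul_right,
      covariance_self (hL a).aemeasurable, (hlaw a).variance_eq, variance_id_gaussianReal]
    ring
  · intro b _ hb
    rw [covariance_const_mul_left, covariance_const_mul_right,
      (hind.indepFun hb.symm).covariance_eq_zero (hL a) (hL b)]
    simp
  · simp

theorem hasLaw_linearForm [IsProbabilityMeasure P]
    (hlaw : ∀ a, HasLaw (Z a) (gaussianReal 0 (s a)) P)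
    (hind : iIndepFun Z P) (c : I → ℝ) {v : ℝ≥0} (hv : ∑ a, c a * c a * s a = v) :
    HasLaw (fun ω => ∑ a, c a * Z a ω) (gaussianReal 0 v) P := by
  have hG : HasGaussianLaw (fun ω => ∑ a, c a * Z a ω) P :=
    hasGaussianLaw_linearForms hlaw hind
      (∑ a, c a • (LinearMap.proj a : (I → ℝ) →ₗ[ℝ] ℝ)) |>.congr
      (ae_of_all _ fun ω => by simp)
  refine ⟨hG.aemeasurable, ?_⟩
  rw [hG.map_eq_gaussianReal]
  have hL : ∀ a, MemLp (Z a) 2 P := fun a => (hlaw a).hasGaussianLaw.memLp_two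
  have h1 : ∫ ω, ∑ a, c a * Z a ω ∂P = 0 := by
    rw [integral_finsetSum _ fun a _ => ((hL a).integrable one_le_two).const_mul _]
    refine Finset.sum_eq_zero fun a _ => ?_
    rw [integral_const_mul, (hlaw a).integral_eq, integral_id_gaussianReal, mul_zero]
  have h2 : Var[fun ω => ∑ a, c a * Z a ω; P] = v := by
    rw [← covariance_self hG.aemeasurable, covariance_linearForms hlaw hind, hv]
  rw [h1, h2, Real.toNNReal_coe]

end LinearForms

/-! ### Measurements, residuals and their independence. -/

section Model
variable {n q m : ℕ}

/-- The variance `‖x_k‖² + σ²` of the measurements of the `k`-th column. -/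
noncomputable def colVar (X : Matrix (Fin n) (Fin q) ℝ) (σ : ℝ≥0) (k : Fin q) : ℝ≥0 :=
  (X.col k ⬝ᵥ X.col k).toNNReal + σ ^ 2

theorem coe_colVar (X : Matrix (Fin n) (Fin q) ℝ) (σ : ℝ≥0) (k : Fin q) :
    (colVar X σ k : ℝ) = X.col k ⬝ᵥ X.col k + (σ : ℝ) ^ 2 := by
  rw [colVar, NNReal.coe_add, Real.coe_toNNReal _ (by rw [← norm_toLp_sq]; positivity)]
  simp

/-- The part of the row `a` of a sensing matrix that is uncorrelated with the measurement `y`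
of the `k`-th column. -/
noncomputable def residual (X : Matrix (Fin n) (Fin q) ℝ) (σ : ℝ≥0) (k : Fin q) (a : Fin n → ℝ) (y : ℝ) :
    Fin n → ℝ :=
  a - (y / colVar X σ k) • X.col k

/-- Coefficients supported on the entries of the `j`-th row of the measurement model. -/
noncomputable def rowCoeff (j : Fin q × Fin m) (f : Fin n → ℝ) (g : ℝ) :
    (Fin q × Fin m × Fin n) ⊕ (Fin q × Fin m) → ℝ :=
  Sum.elim (fun t => if t.1 = j.1 then if t.2.1 = j.2 then f t.2.2 else 0 else 0)
    (fun t => if t = j then g else 0)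

theorem sum_rowCoeff_mul (j : Fin q × Fin m) (f : Fin n → ℝ) (g : ℝ)
    (z : (Fin q × Fin m × Fin n) ⊕ (Fin q × Fin m) → ℝ) :
    ∑ a, rowCoeff j f g a * z a =
      ∑ l, f l * z (Sum.inl (j.1, j.2, l)) + g * z (Sum.inr j) := by
  rw [Fintype.sum_sum_type]
  congr 1
  · rw [Fintype.sum_prod_type, Finset.sum_eq_single j.1, Fintype.sum_prod_type,
      Finset.sum_eq_single j.2]
    · simp [rowCoeff]
    · intro b _ hb; simp [rowCoeff, hb]
    · simp
    · intro b _ hb; simp [rowCoeff, hb]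
    · simp
  · rw [Finset.sum_eq_single j]
    · simp [rowCoeff]
    · intro b _ hb; simp [rowCoeff, hb]
    · simp

/-- The variances of the entries of the model. -/
noncomputable def entryVar (σ : ℝ≥0) : (Fin q × Fin m × Fin n) ⊕ (Fin q × Fin m) → ℝ≥0 :=
  Sum.elim (fun _ => 1) (fun _ => σ ^ 2)

theorem sum_rowCoeff_mul_rowCoeff (σ : ℝ≥0) (j : Fin q × Fin m) (f f' : Fin n → ℝ) (g g' : ℝ) :
    ∑ a, rowCoeff j f g a * rowCoeff j f' g' a * entryVar σ a =
      f ⬝ᵥ f' + g * g' * (σ : ℝ) ^ 2 := by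
  simp only [mul_assoc]
  rw [sum_rowCoeff_mul j f g (fun a => rowCoeff j f' g' a * entryVar σ a)]
  simp [rowCoeff, entryVar, dotProduct]

theorem sum_rowCoeff_mul_rowCoeff_of_ne (σ : ℝ≥0) {j j' : Fin q × Fin m} (hj : j ≠ j')
    (f f' : Fin n → ℝ) (g g' : ℝ) :
    ∑ a, rowCoeff j f g a * rowCoeff j' f' g' a * entryVar σ a = 0 := by
  simp only [mul_assoc]
  rw [sum_rowCoeff_mul j f g (fun a => rowCoeff j' f' g' a * entryVar σ a)]
  have h : ¬ (j.1 = j'.1 ∧ j.2 = j'.2) := fun h => hj (Prod.ext h.1 h.2)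
  have h1 : ∀ l, rowCoeff j' f' g' (Sum.inl (j.1, j.2, l)) = 0 := by
    intro l
    simp only [rowCoeff, Sum.elim_inl]
    split_ifs with h1 h2
    · exact absurd ⟨h1, h2⟩ h
    · rfl
    · rfl
  simp [h1]
  simp [rowCoeff, hj]

variable {Ω : Type*} {σ : ℝ≥0} {A : Fin q → Ω → Matrix (Fin m) (Fin n) ℝ} {v : Fin q → Ω → Fin m → ℝ}

/-- The family of all entries of the model. -/
noncomputable def entry (A : Fin q → Ω → Matrix (Fin m) (Fin n) ℝ) (v : Fin q → Ω → Fin m → ℝ)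
    (a : (Fin q × Fin m × Fin n) ⊕ (Fin q × Fin m)) (ω : Ω) : ℝ :=
  Sum.elim (fun t => A t.1 ω t.2.1 t.2.2) (fun t => v t.1 ω t.2) a

/-- The `j`-th scalar measurement as a random variable. -/
noncomputable def obs (X : Matrix (Fin n) (Fin q) ℝ) (A : Fin q → Ω → Matrix (Fin m) (Fin n) ℝ)
    (v : Fin q → Ω → Fin m → ℝ) (j : Fin q × Fin m) (ω : Ω) : ℝ :=
  measurements X (fun k => A k ω) (fun k => v k ω) j.1 j.2

/-- The component in direction `w` of the residual of the `j`-th sensing vector. -/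
noncomputable def resid (X : Matrix (Fin n) (Fin q) ℝ) (σ : ℝ≥0) (A : Fin q → Ω → Matrix (Fin m) (Fin n) ℝ)
    (v : Fin q → Ω → Fin m → ℝ) (w : Fin n → ℝ) (j : Fin q × Fin m) (ω : Ω) : ℝ :=
  w ⬝ᵥ residual X σ j.1 (A j.1 ω j.2) (obs X A v j ω)

theorem obs_eq_sum (X : Matrix (Fin n) (Fin q) ℝ) (j : Fin q × Fin m) (ω : Ω) :
    obs X A v j ω = ∑ a, rowCoeff j (X.col j.1) 1 a * entry A v a ω := by
  rw [sum_rowCoeff_mul j (X.col j.1) 1 (fun a => entry A v a ω)]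
  simp [obs, measurements, entry, mulVec, dotProduct, mul_comm]

theorem resid_eq_sum (X : Matrix (Fin n) (Fin q) ℝ) (w : Fin n → ℝ) (j : Fin q × Fin m) (ω : Ω) :
    resid X σ A v w j ω = ∑ a, rowCoeff j
      (w - (w ⬝ᵥ X.col j.1 / colVar X σ j.1) • X.col j.1)
      (-(w ⬝ᵥ X.col j.1 / colVar X σ j.1)) a * entry A v a ω := by
  rw [sum_rowCoeff_mul j _ _ (fun a => entry A v a ω)]
  set β := w ⬝ᵥ X.col j.1 / (colVar X σ j.1 : ℝ) with hβ
  have h1 : ∑ l, (w - β • X.col j.1) l * entry A v (Sum.inl (j.1, j.2, l)) ω =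
      w ⬝ᵥ A j.1 ω j.2 - β * (A j.1 ω j.2 ⬝ᵥ X.col j.1) := by
    simp only [Pi.sub_apply, Pi.smul_apply, smul_eq_mul, sub_mul, Finset.sum_sub_distrib,
      dotProduct, Finset.mul_sum, entry, Sum.elim_inl]
    congr 1
    refine Finset.sum_congr rfl fun l _ => by ring
  have h2 : obs X A v j ω = A j.1 ω j.2 ⬝ᵥ X.col j.1 + v j.1 ω j.2 := rfl
  rw [h1, resid, residual, dotProduct_sub, dotProduct_smul, h2, smul_eq_mul]
  simp only [entry, Sum.elim_inr]
  rw [hβ]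
  ring

/-- Zero variance forces `x_k = 0`, so the convention `x / 0 = 0` is harmless and no nondegeneracy
assumption is needed. -/
theorem colVar_mul_div_self (X : Matrix (Fin n) (Fin q) ℝ) (σ : ℝ≥0) (k : Fin q)
    (w : Fin n → ℝ) :
    w ⬝ᵥ X.col k / (colVar X σ k : ℝ) * colVar X σ k = w ⬝ᵥ X.col k := by
  rcases eq_or_ne (colVar X σ k : ℝ) 0 with h | h
  · rw [h, mul_zero]
    rw [coe_colVar, ← norm_toLp_sq] at h
    have h0 : ‖WithLp.toLp 2 (X.col k)‖ ^ 2 = 0 := by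
      nlinarith [sq_nonneg ‖WithLp.toLp 2 (X.col k)‖, sq_nonneg (σ : ℝ)]
    have h1 : X.col k = 0 := by simpa using h0
    rw [h1, dotProduct_zero]
  · exact div_mul_cancel₀ _ h

variable [MeasurableSpace Ω] {P : Measure Ω}

theorem IsGaussianModel.hasLaw_entry (h : IsGaussianModel P σ A v)
    (a : (Fin q × Fin m × Fin n) ⊕ (Fin q × Fin m)) :
    HasLaw (entry A v a) (gaussianReal 0 (entryVar σ a)) P := by
  rcases a with t | t
  · exact h.law_A t.1 t.2.1 t.2.2
  · exact h.law_v t.1 t.2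

variable [IsProbabilityMeasure P]

theorem IsGaussianModel.hasLaw_obs (h : IsGaussianModel P σ A v) (X : Matrix (Fin n) (Fin q) ℝ)
    (j : Fin q × Fin m) : HasLaw (obs X A v j) (gaussianReal 0 (colVar X σ j.1)) P := by
  have := hasLaw_linearForm h.hasLaw_entry h.indep (rowCoeff j (X.col j.1) 1)
    (v := colVar X σ j.1) (by rw [sum_rowCoeff_mul_rowCoeff, coe_colVar]; ring)
  simpa only [← obs_eq_sum] using this

theorem IsGaussianModel.iIndepFun_obs (h : IsGaussianModel P σ A v)
    (X : Matrix (Fin n) (Fin q) ℝ) : iIndepFun (obs X A v) P := by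
  refine HasGaussianLaw.iIndepFun_of_covariance_eq_zero ?_ fun j j' hj => ?_
  · refine (hasGaussianLaw_linearForms h.hasLaw_entry h.indep
      (Matrix.mulVecLin (Matrix.of fun j => rowCoeff j (X.col j.1) 1))).congr
      (ae_of_all _ fun ω => ?_)
    ext j
    exact (obs_eq_sum X j ω).symm
  · have := covariance_linearForms h.hasLaw_entry h.indep (rowCoeff j (X.col j.1) 1)
      (rowCoeff j' (X.col j'.1) 1)
    simp only [← obs_eq_sum] at this
    exact this.trans (sum_rowCoeff_mul_rowCoeff_of_ne σ hj _ _ _ _)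

theorem IsGaussianModel.iIndepFun_resid (h : IsGaussianModel P σ A v)
    (X : Matrix (Fin n) (Fin q) ℝ) (w : Fin n → ℝ) : iIndepFun (resid X σ A v w) P := by
  refine HasGaussianLaw.iIndepFun_of_covariance_eq_zero ?_ fun j j' hj => ?_
  · refine (hasGaussianLaw_linearForms h.hasLaw_entry h.indep
      (Matrix.mulVecLin (Matrix.of fun j => rowCoeff j
        (w - (w ⬝ᵥ X.col j.1 / colVar X σ j.1) • X.col j.1)
        (-(w ⬝ᵥ X.col j.1 / colVar X σ j.1))))).congr
      (ae_of_all _ fun ω => ?_)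
    ext j
    exact (resid_eq_sum X w j ω).symm
  · have := covariance_linearForms h.hasLaw_entry h.indep
      (rowCoeff j (w - (w ⬝ᵥ X.col j.1 / colVar X σ j.1) • X.col j.1)
        (-(w ⬝ᵥ X.col j.1 / colVar X σ j.1)))
      (rowCoeff j' (w - (w ⬝ᵥ X.col j'.1 / colVar X σ j'.1) • X.col j'.1)
        (-(w ⬝ᵥ X.col j'.1 / colVar X σ j'.1)))
    simp only [← resid_eq_sum] at this
    exact this.trans (sum_rowCoeff_mul_rowCoeff_of_ne σ hj _ _ _ _)

/-- Jointly Gaussian vectors are independent once their cross-covariances vanish: distinct rows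
share no entries, and within a row the regression coefficient is chosen to cancel the covariance.
Independence from the entire vector of measurements is what permits a truncation level depending on
all of them. -/
theorem IsGaussianModel.indepFun_obs_resid (h : IsGaussianModel P σ A v)
    (X : Matrix (Fin n) (Fin q) ℝ) (w : Fin n → ℝ) :
    IndepFun (fun ω j => obs X A v j ω) (fun ω j => resid X σ A v w j ω) P := by
  refine HasGaussianLaw.indepFun_of_covariance_eval ?_ fun j j' => ?_
  · refine (hasGaussianLaw_linearForms h.hasLaw_entry h.indep
      (LinearMap.prod (Matrix.mulVecLin (Matrix.of fun j => rowCoeff j (X.col j.1) 1))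
      (Matrix.mulVecLin (Matrix.of fun j => rowCoeff j
        (w - (w ⬝ᵥ X.col j.1 / colVar X σ j.1) • X.col j.1)
        (-(w ⬝ᵥ X.col j.1 / colVar X σ j.1)))))).congr
      (ae_of_all _ fun ω => ?_)
    refine Prod.ext ?_ ?_
    · ext j
      simp only [obs_eq_sum]; rfl
    · ext j
      simp only [resid_eq_sum]; rfl
  · have := covariance_linearForms h.hasLaw_entry h.indep (rowCoeff j (X.col j.1) 1)
      (rowCoeff j' (w - (w ⬝ᵥ X.col j'.1 / colVar X σ j'.1) • X.col j'.1)
        (-(w ⬝ᵥ X.col j'.1 / colVar X σ j'.1)))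
    simp only [← resid_eq_sum, ← obs_eq_sum] at this
    refine this.trans ?_
    rcases eq_or_ne j j' with rfl | hj
    · rw [sum_rowCoeff_mul_rowCoeff, dotProduct_sub, dotProduct_smul, smul_eq_mul]
      have h1 := colVar_mul_div_self X σ j.1 w
      rw [dotProduct_comm w] at h1 ⊢
      have h2 := coe_colVar X σ j.1
      linear_combination X.col j.1 ⬝ᵥ w / (colVar X σ j.1 : ℝ) * h2 - h1
    · exact sum_rowCoeff_mul_rowCoeff_of_ne σ hj _ _ _ _

/-- Regression only lowers variance: it equals `‖w‖² - β² Var y`, with `β` the regression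
coefficient. -/
theorem IsGaussianModel.exists_hasLaw_resid (h : IsGaussianModel P σ A v)
    (X : Matrix (Fin n) (Fin q) ℝ) (w : Fin n → ℝ) (hw : w ⬝ᵥ w ≤ 1) :
    ∃ s : Fin q × Fin m → ℝ≥0, (∀ j, s j ≤ 1) ∧
      ∀ j, HasLaw (resid X σ A v w j) (gaussianReal 0 (s j)) P := by
  have key : ∀ j : Fin q × Fin m, ∃ s : ℝ≥0, s ≤ 1 ∧
      HasLaw (resid X σ A v w j) (gaussianReal 0 s) P := by
    intro j
    set β := w ⬝ᵥ X.col j.1 / (colVar X σ j.1 : ℝ) with hβ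
    set S : ℝ := ∑ a, rowCoeff j (w - β • X.col j.1) (-β) a *
      rowCoeff j (w - β • X.col j.1) (-β) a * entryVar σ a with hS
    have h0 : 0 ≤ S := Finset.sum_nonneg fun a _ =>
      mul_nonneg (mul_self_nonneg _) (NNReal.coe_nonneg _)
    have h1 : S = w ⬝ᵥ w - β ^ 2 * colVar X σ j.1 := by
      rw [hS, sum_rowCoeff_mul_rowCoeff]
      simp only [dotProduct_sub, sub_dotProduct, dotProduct_smul, smul_dotProduct, smul_eq_mul]
      rw [dotProduct_comm (X.col j.1) w]
      have e1 : β * colVar X σ j.1 = w ⬝ᵥ X.col j.1 := colVar_mul_div_self X σ j.1 w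
      have e2 := coe_colVar X σ j.1
      linear_combination 2 * β * e1 - β ^ 2 * e2
    refine ⟨S.toNNReal, ?_, ?_⟩
    · rw [Real.toNNReal_le_one, h1]
      nlinarith [mul_nonneg (sq_nonneg β) (colVar X σ j.1).coe_nonneg]
    · have := hasLaw_linearForm h.hasLaw_entry h.indep
        (rowCoeff j (w - β • X.col j.1) (-β)) (v := S.toNNReal)
        (Real.coe_toNNReal S h0).symm
      simpa only [hβ, ← resid_eq_sum] using this
  choose s hs1 hs2 using key
  exact ⟨s, hs1, hs2⟩

end Model
-- Splitting the initialization matrix into signal and noise.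
section Decomposition
variable {n q m : ℕ}

/-- The truncated measurements, as a function of all the measurements. -/
noncomputable def obsTrunc (κ μ : ℝ) (y : Fin q × Fin m → ℝ) (j : Fin q × Fin m) : ℝ :=
  trunc (truncLevel κ μ fun k i => y (k, i)) (fun i => y (j.1, i)) j.2

theorem truncLevel_eq (κ μ : ℝ) (y : Fin q × Fin m → ℝ) :
    truncLevel κ μ (fun k i => y (k, i)) =
      9 * κ ^ 2 * μ ^ 2 * (1 / ((m : ℝ) * q)) * ∑ j, y j ^ 2 := by
  rw [truncLevel, Fintype.sum_prod_type]

theorem truncLevel_nonneg (κ μ : ℝ) (y : Fin q × Fin m → ℝ) :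
    0 ≤ truncLevel κ μ fun k i => y (k, i) := by
  rw [truncLevel_eq]; positivity

theorem obsTrunc_sq_le (κ μ : ℝ) (y : Fin q × Fin m → ℝ) (j : Fin q × Fin m) :
    obsTrunc κ μ y j ^ 2 ≤ truncLevel κ μ fun k i => y (k, i) := by
  have h0 := truncLevel_nonneg κ μ y
  unfold obsTrunc trunc
  split_ifs with h
  · rw [← sq_abs]
    calc _ ≤ (√(truncLevel κ μ fun k i => y (k, i))) ^ 2 := by gcongr
      _ = _ := Real.sq_sqrt h0
  · simpa using h0

theorem obsTrunc_mul_self_nonneg (κ μ : ℝ) (y : Fin q × Fin m → ℝ) (j : Fin q × Fin m) :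
    0 ≤ obsTrunc κ μ y j * y j := by
  unfold obsTrunc trunc
  split_ifs
  · exact mul_self_nonneg (y j)
  · simp

theorem measurable_truncLevel (κ μ : ℝ) :
    Measurable fun y : Fin q × Fin m → ℝ => truncLevel κ μ fun k i => y (k, i) := by
  simp only [truncLevel_eq]
  fun_prop

theorem measurable_obsTrunc (κ μ : ℝ) (j : Fin q × Fin m) :
    Measurable fun y : Fin q × Fin m → ℝ => obsTrunc κ μ y j := by
  unfold obsTrunc trunc
  refine Measurable.ite (measurableSet_le ?_ ?_) ?_ measurable_const
  · exact (measurable_pi_apply (j.1, j.2)).abs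
  · exact (measurable_truncLevel κ μ).sqrt
  · exact measurable_pi_apply (j.1, j.2)

/-- The diagonal of the signal part of the initialization matrix. -/
noncomputable def signalWeight (X : Matrix (Fin n) (Fin q) ℝ) (σ : ℝ≥0) (κ μ : ℝ)
    (y : Fin q × Fin m → ℝ) (k : Fin q) : ℝ :=
  1 / (m : ℝ) * ∑ i, obsTrunc κ μ y (k, i) * y (k, i) / colVar X σ k

/-- The noise part of the initialization matrix. -/
noncomputable def noisePart (X : Matrix (Fin n) (Fin q) ℝ) (σ : ℝ≥0) (κ μ : ℝ)
    (A : Fin q → Matrix (Fin m) (Fin n) ℝ) (y : Fin q × Fin m → ℝ) : Matrix (Fin n) (Fin q) ℝ :=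
  Matrix.of fun l k =>
    1 / (m : ℝ) * ∑ i, obsTrunc κ μ y (k, i) * residual X σ k (A k i) (y (k, i)) l

theorem initMatrix_eq (X : Matrix (Fin n) (Fin q) ℝ) (σ : ℝ≥0) (κ μ : ℝ)
    (A : Fin q → Matrix (Fin m) (Fin n) ℝ) (y : Fin q × Fin m → ℝ) :
    initMatrix κ μ A (fun k i => y (k, i)) =
      X * diagonal (signalWeight X σ κ μ y) + noisePart X σ κ μ A y := by
  ext l k
  have h1 : initMatrix κ μ A (fun k i => y (k, i)) l k =
      1 / (m : ℝ) * ∑ i, A k i l * obsTrunc κ μ y (k, i) := by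
    rw [initMatrix, Matrix.smul_apply, Matrix.sum_apply, smul_eq_mul, Finset.sum_eq_single k]
    · simp only [vecMulVec_apply, Pi.single_eq_same, mul_one]
      rfl
    · intro b _ hb
      rw [vecMulVec_apply, Pi.single_eq_of_ne hb.symm, mul_zero]
    · simp
  rw [h1, Matrix.add_apply, Matrix.mul_diagonal, signalWeight, noisePart, Matrix.of_apply,
    mul_left_comm, ← mul_add]
  congr 1
  rw [Finset.mul_sum, ← Finset.sum_add_distrib]
  refine Finset.sum_congr rfl fun i _ => ?_
  simp only [residual, Pi.sub_apply, Pi.smul_apply, smul_eq_mul, Matrix.col_apply]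
  ring

theorem dotProduct_noisePart_mulVec (X : Matrix (Fin n) (Fin q) ℝ) (σ : ℝ≥0) (κ μ : ℝ)
    (A : Fin q → Matrix (Fin m) (Fin n) ℝ) (y : Fin q × Fin m → ℝ) (w : Fin n → ℝ)
    (z : Fin q → ℝ) :
    w ⬝ᵥ noisePart X σ κ μ A y *ᵥ z =
      ∑ j : Fin q × Fin m, 1 / (m : ℝ) * z j.1 * obsTrunc κ μ y j *
        (w ⬝ᵥ residual X σ j.1 (A j.1 j.2) (y j)) := by
  simp only [dotProduct, mulVec, noisePart, Matrix.of_apply, Finset.mul_sum, Finset.sum_mul,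
    Fintype.sum_prod_type]
  rw [Finset.sum_comm]
  refine Finset.sum_congr rfl fun k _ => ?_
  rw [Finset.sum_comm]
  refine Finset.sum_congr rfl fun i _ => Finset.sum_congr rfl fun l _ => ?_
  ring

/-- The fraction of the measurements of the `k`-th column lying between half a standard deviation
and one standard deviation. -/
noncomputable def midFraction (X : Matrix (Fin n) (Fin q) ℝ) (σ : ℝ≥0)
    (y : Fin q × Fin m → ℝ) (k : Fin q) : ℝ :=
  1 / (m : ℝ) * ∑ i, (Set.Icc (√(colVar X σ k : ℝ) / 2) (√(colVar X σ k))).indicator 1 (y (k, i))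

theorem midFraction_nonneg (X : Matrix (Fin n) (Fin q) ℝ) (σ : ℝ≥0)
    (y : Fin q × Fin m → ℝ) (k : Fin q) : 0 ≤ midFraction X σ y k :=
  mul_nonneg (by positivity) (Finset.sum_nonneg fun _ _ =>
    Set.indicator_nonneg (fun _ _ => zero_le_one) _)

theorem midFraction_le_one (hm : 0 < m) (X : Matrix (Fin n) (Fin q) ℝ) (σ : ℝ≥0)
    (y : Fin q × Fin m → ℝ) (k : Fin q) : midFraction X σ y k ≤ 1 := by
  have h : ∑ i : Fin m, (Set.Icc (√(colVar X σ k : ℝ) / 2) (√(colVar X σ k))).indicator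
      (1 : ℝ → ℝ) (y (k, i)) ≤ ∑ _i : Fin m, 1 :=
    Finset.sum_le_sum fun i _ =>
      Set.indicator_le_self' (f := (1 : ℝ → ℝ)) (fun _ _ => zero_le_one' ℝ) _
  have hm' : (0 : ℝ) < m := by exact_mod_cast hm
  rw [midFraction, one_div, inv_mul_le_iff₀ hm']
  simpa using h

/-- A measurement in the middle range survives truncation and has `y² ≥ Var y / 4`; all other terms
of the signal weight are nonnegative. The lower bound no longer involves the random truncation
level, so its terms are independent. -/
theorem midFraction_le_signalWeight (X : Matrix (Fin n) (Fin q) ℝ) (σ : ℝ≥0) (κ μ : ℝ)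
    (y : Fin q × Fin m → ℝ) (k : Fin q) (h0 : colVar X σ k ≠ 0)
    (hk : (colVar X σ k : ℝ) ≤ truncLevel κ μ fun k i => y (k, i)) :
    midFraction X σ y k ≤ 4 * signalWeight X σ κ μ y k := by
  have hpos : (0 : ℝ) < colVar X σ k := by positivity
  rw [midFraction, signalWeight, mul_left_comm]
  refine mul_le_mul_of_nonneg_left ?_ (by positivity)
  rw [Finset.mul_sum]
  refine Finset.sum_le_sum fun i _ => ?_
  by_cases hy : y (k, i) ∈ Set.Icc (√(colVar X σ k : ℝ) / 2) (√(colVar X σ k))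
  · have hy0 : 0 ≤ y (k, i) := le_trans (by positivity) hy.1
    have e : obsTrunc κ μ y (k, i) = y (k, i) := by
      unfold obsTrunc trunc
      refine if_pos ?_
      rw [abs_of_nonneg hy0]
      exact hy.2.trans (Real.sqrt_le_sqrt hk)
    have h1 : (√(colVar X σ k : ℝ) / 2) ^ 2 ≤ y (k, i) ^ 2 := by
      have := hy.1
      gcongr
    rw [div_pow, Real.sq_sqrt hpos.le] at h1
    rw [Set.indicator_of_mem hy, e, Pi.one_apply, mul_div_assoc', le_div_iff₀ hpos]
    nlinarith
  · rw [Set.indicator_of_notMem hy]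
    have := obsTrunc_mul_self_nonneg κ μ y (k, i)
    positivity

end Decomposition

/-! ### Tail bounds for the energy, the signal and the noise. -/

section Events
variable {n q m : ℕ} {Ω : Type*} [MeasurableSpace Ω] {P : Measure Ω} [IsProbabilityMeasure P]
  {σ : ℝ≥0} {A : Fin q → Ω → Matrix (Fin m) (Fin n) ℝ} {v : Fin q → Ω → Fin m → ℝ}

theorem IsGaussianModel.measure_energy_ge (h : IsGaussianModel P σ A v)
    (X : Matrix (Fin n) (Fin q) ℝ) {R : ℝ} (hR : 0 < R) (hX : ∀ k, (colVar X σ k : ℝ) ≤ R) :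
    P {ω | 4 * (m * ∑ k, (colVar X σ k : ℝ)) ≤ ∑ j, obs X A v j ω ^ 2} ≤
      ENNReal.ofReal (Real.exp (-(m * ∑ k, (colVar X σ k : ℝ)) / (2 * R))) := by
  set T := m * ∑ k, (colVar X σ k : ℝ) with hT
  have hTsum : ∑ j : Fin q × Fin m, (colVar X σ j.1 : ℝ) = T := by
    rw [Fintype.sum_prod_type, hT, Finset.mul_sum]; simp
  have h1 := measure_sum_ge_le (h.iIndepFun_obs X) (fun j => (h.hasLaw_obs X j).aemeasurable)
    (fun _ x => x ^ 2 / (4 * R)) (fun _ => by fun_prop)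
    (fun j => (colVar X σ j.1 : ℝ) / (2 * R))
    (fun j => by
      rw [(h.hasLaw_obs X j).map_eq]
      exact lintegral_exp_sq_div_le hR (hX j.1)) (T / R)
  rw [← Finset.sum_div, hTsum] at h1
  refine (measure_mono fun ω hω => ?_).trans (h1.trans_eq ?_)
  · simp only [Set.mem_ofPred_eq, ← Finset.sum_div] at hω ⊢
    rw [div_le_div_iff₀ hR (by positivity)]
    nlinarith
  · congr 2
    field_simp
    ring

theorem IsGaussianModel.measure_energy_le (h : IsGaussianModel P σ A v)
    (X : Matrix (Fin n) (Fin q) ℝ) {R : ℝ} (hR : 0 < R) (hX : ∀ k, (colVar X σ k : ℝ) ≤ R) :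
    P {ω | ∑ j, obs X A v j ω ^ 2 ≤ (m * ∑ k, (colVar X σ k : ℝ)) / 4} ≤
      ENNReal.ofReal (Real.exp (-(m * ∑ k, (colVar X σ k : ℝ)) / (8 * R))) := by
  set T := m * ∑ k, (colVar X σ k : ℝ) with hT
  have hTsum : ∑ j : Fin q × Fin m, -(colVar X σ j.1 : ℝ) = -T := by
    rw [Fintype.sum_prod_type, hT, Finset.mul_sum]; simp
  have h1 := measure_sum_ge_le (h.iIndepFun_obs X) (fun j => (h.hasLaw_obs X j).aemeasurable)
    (fun _ x => -x ^ 2 / (2 * R)) (fun _ => by fun_prop)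
    (fun j => -(colVar X σ j.1 : ℝ) / (4 * R))
    (fun j => by
      rw [(h.hasLaw_obs X j).map_eq]
      exact lintegral_exp_neg_sq_div_le hR (hX j.1)) (-T / (8 * R))
  rw [← Finset.sum_div, hTsum] at h1
  refine (measure_mono fun ω hω => ?_).trans (h1.trans_eq ?_)
  · simp only [Set.mem_ofPred_eq, ← Finset.sum_div, Finset.sum_neg_distrib] at hω ⊢
    rw [div_le_div_iff₀ (by positivity) (by positivity)]
    nlinarith
  · congr 2
    field_simp
    ring

/-- Lower-tail Chernoff with tilt `l p_k²` on column `k`; `hlp` keeps each tilt in the range of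
`lintegral_exp_neg_indicator_le`. The exponents sum to `-l m / 20`, and the threshold 1/40 gives
back half of that. -/
theorem IsGaussianModel.measure_midFraction_le (h : IsGaussianModel P σ A v) (hm : 0 < m)
    (X : Matrix (Fin n) (Fin q) ℝ) (p : Fin q → ℝ) (hp : ∑ k, p k ^ 2 = 1) {l : ℝ} (hl : 0 ≤ l)
    (hlp : ∀ k, l * p k ^ 2 ≤ 1) (hp0 : ∀ k, colVar X σ k = 0 → p k = 0) :
    P {ω | ∑ k, midFraction X σ (fun j => obs X A v j ω) k * p k ^ 2 < 1 / 40} ≤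
      ENNReal.ofReal (Real.exp (-(l * m / 40))) := by
  have hm' : (0 : ℝ) < m := by exact_mod_cast hm
  set I : Fin q → Set ℝ := fun k => Set.Icc (√(colVar X σ k : ℝ) / 2) (√(colVar X σ k)) with hI
  have h1 := measure_sum_ge_le (h.iIndepFun_obs X) (fun j => (h.hasLaw_obs X j).aemeasurable)
    (fun j x => -(l * p j.1 ^ 2 * (I j.1).indicator 1 x))
    (fun j => ((measurable_one.indicator measurableSet_Icc).const_mul _).neg)
    (fun j => -(l * p j.1 ^ 2 / 20))
    (fun j => by
      rw [(h.hasLaw_obs X j).map_eq]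
      rcases eq_or_ne (colVar X σ j.1) 0 with h0 | h0
      · rw [hp0 _ h0]; simp
      · exact lintegral_exp_neg_indicator_le h0 (by positivity) (hlp j.1)) (-(l * m / 40))
  refine (measure_mono fun ω hω => ?_).trans (h1.trans (ENNReal.ofReal_le_ofReal
    (Real.exp_le_exp.2 (le_of_eq ?_))))
  · simp only [Set.mem_ofPred_eq] at hω ⊢
    rw [Finset.sum_neg_distrib, neg_le_neg_iff]
    have e : ∑ j : Fin q × Fin m, l * p j.1 ^ 2 * (I j.1).indicator 1 (obs X A v j ω) =
        l * m * ∑ k, midFraction X σ (fun j => obs X A v j ω) k * p k ^ 2 := by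
      rw [Fintype.sum_prod_type, Finset.mul_sum]
      refine Finset.sum_congr rfl fun k _ => ?_
      simp only [midFraction, hI, ← Finset.mul_sum]
      field_simp
    rw [e]
    have : 0 ≤ l * m := by positivity
    nlinarith
  · have e : ∑ j : Fin q × Fin m, -(l * p j.1 ^ 2 / 20) = -(l * m / 20) := by
      rw [Fintype.sum_prod_type]
      simp only [Finset.sum_neg_distrib, Finset.sum_const, Finset.card_univ, Fintype.card_fin,
        nsmul_eq_mul, ← Finset.mul_sum, ← Finset.sum_div, hp]
      ring
    rw [e]
    ring

theorem IsGaussianModel.measure_noisePart_ge (h : IsGaussianModel P σ A v) (hm : 0 < m)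
    (X : Matrix (Fin n) (Fin q) ℝ) (κ μ : ℝ) (w : Fin n → ℝ) (z : Fin q → ℝ)
    (hw : w ⬝ᵥ w ≤ 1) (hz : z ⬝ᵥ z ≤ 1) {a t : ℝ} (ha : 0 < a) (ht : 0 ≤ t) :
    P {ω | truncLevel κ μ (fun k i => obs X A v (k, i) ω) ≤ a ∧
      t ≤ w ⬝ᵥ noisePart X σ κ μ (fun k => A k ω) (fun j => obs X A v j ω) *ᵥ z} ≤
      ENNReal.ofReal (Real.exp (-(t ^ 2 * m / (2 * a)))) := by
  have hm' : (0 : ℝ) < m := by exact_mod_cast hm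
  obtain ⟨s, hs1, hs2⟩ := h.exists_hasLaw_resid X w hw
  have h1 := measure_sum_mul_ge_le (fun j => (h.hasLaw_obs X j).aemeasurable)
    (h.indepFun_obs_resid X w) (h.iIndepFun_resid X w) s hs1 hs2
    {y | truncLevel κ μ (fun k i => y (k, i)) ≤ a}
    (measurableSet_le (measurable_truncLevel κ μ) measurable_const)
    (fun y j => 1 / (m : ℝ) * z j.1 * obsTrunc κ μ y j)
    (measurable_pi_lambda _ fun j => (measurable_obsTrunc κ μ j).const_mul _)
    (K := a / m) (t := t) (by positivity) ht (fun y hy => by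
      have hy' : truncLevel κ μ (fun k i => y (k, i)) ≤ a := hy
      have h2 : ∀ j : Fin q × Fin m, (1 / (m : ℝ) * z j.1 * obsTrunc κ μ y j) ^ 2 ≤
          (1 / (m : ℝ)) ^ 2 * a * z j.1 ^ 2 := by
        intro j
        have := (obsTrunc_sq_le κ μ y j).trans hy'
        rw [mul_pow, mul_pow, mul_right_comm]
        have h3 : 0 ≤ (1 / (m : ℝ)) ^ 2 * z j.1 ^ 2 := by positivity
        nlinarith
      refine (Finset.sum_le_sum fun j _ => h2 j).trans ?_
      rw [← Finset.mul_sum, Fintype.sum_prod_type]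
      simp only [Finset.sum_const, Finset.card_univ, Fintype.card_fin, nsmul_eq_mul,
        ← Finset.mul_sum]
      have h4 : ∑ k, z k ^ 2 ≤ 1 := by simpa only [dotProduct, ← pow_two] using hz
      have h5 : (1 / (m : ℝ)) ^ 2 * a * (m * ∑ k, z k ^ 2) = a / m * ∑ k, z k ^ 2 := by
        field_simp
      rw [h5]
      exact mul_le_of_le_one_right (by positivity) h4)
  refine (measure_mono fun ω hω => ?_).trans (h1.trans_eq ?_)
  · refine ⟨hω.1, ?_⟩
    have := hω.2
    rw [dotProduct_noisePart_mulVec] at this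
    exact this
  · congr 3
    field_simp

end Events
-- Consequences of the SVD, and the conclusion on the good event.
section SingularValues
variable {n q r : ℕ} {X : Matrix (Fin n) (Fin q) ℝ} {U : Matrix (Fin n) (Fin r) ℝ}
  {s : Fin r → ℝ} {V : Matrix (Fin q) (Fin r) ℝ}

theorem IsSVD.pos_of_rank_eq (h : IsSVD X U s V) (hX : X.rank = r) (i : Fin r) : 0 < s i := by
  refine lt_of_le_of_ne (h.nonneg i) fun h0 => ?_
  have h1 : X.rank ≤ (diagonal s).rank := by
    rw [h.eq]
    exact (Matrix.rank_mul_le_left _ _).trans (Matrix.rank_mul_le_right _ _)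
  rw [Matrix.rank_diagonal, hX] at h1
  have h2 := Fintype.card_subtype_lt (p := fun i => s i ≠ 0) (x := i) (by simp [← h0])
  rw [Fintype.card_fin] at h2
  omega

theorem sigmaMin_le (s : Fin r → ℝ) (i : Fin r) : sigmaMin s ≤ s i :=
  ciInf_le (Set.finite_range s).bddBelow i

theorem le_sigmaMax (s : Fin r → ℝ) (i : Fin r) : s i ≤ sigmaMax s :=
  le_ciSup (Set.finite_range s).bddAbove i

theorem sigmaMin_pos (hr : 1 ≤ r) (hs : ∀ i, 0 < s i) : 0 < sigmaMin s := by
  have : Nonempty (Fin r) := ⟨⟨0, hr⟩⟩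
  obtain ⟨i, hi⟩ := exists_eq_ciInf_of_finite (f := s)
  rw [sigmaMin, ← hi]
  exact hs i

theorem IsSVD.col_eq (h : IsSVD X U s V) (k : Fin q) :
    X.col k = U *ᵥ (diagonal s * Vᵀ).col k := by
  ext i
  rw [h.eq, Matrix.mul_assoc, Matrix.col_apply, Matrix.mul_apply]
  rfl

theorem IsSVD.norm_col (h : IsSVD X U s V) (k : Fin q) :
    ‖WithLp.toLp 2 (X.col k)‖ = ‖WithLp.toLp 2 ((diagonal s * Vᵀ).col k)‖ := by
  rw [h.col_eq, norm_toLp_mulVec_of_orthonormal U h.left_orthonormal]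

theorem IsSVD.col_dotProduct_self (h : IsSVD X U s V) (k : Fin q) :
    X.col k ⬝ᵥ X.col k = ∑ i, s i ^ 2 * V k i ^ 2 := by
  rw [← norm_toLp_sq, h.norm_col, norm_toLp_sq, dotProduct]
  refine Finset.sum_congr rfl fun i _ => ?_
  rw [Matrix.col_apply, Matrix.diagonal_mul, Matrix.transpose_apply]
  ring

theorem IsSVD.sum_col_dotProduct_self (h : IsSVD X U s V) :
    ∑ k, X.col k ⬝ᵥ X.col k = ∑ i, s i ^ 2 := by
  simp only [h.col_dotProduct_self]
  rw [Finset.sum_comm]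
  refine Finset.sum_congr rfl fun i _ => ?_
  rw [← Finset.mul_sum]
  have h1 : ∑ k, V k i ^ 2 = (Vᵀ * V) i i := by
    simp [Matrix.mul_apply, pow_two]
  rw [h1, h.right_orthonormal, Matrix.one_apply_eq, mul_one]

theorem IsSVD.sigmaMin_sq_mul_row_le (h : IsSVD X U s V) (h0 : 0 ≤ sigmaMin s) (k : Fin q) :
    sigmaMin s ^ 2 * ∑ i, V k i ^ 2 ≤ X.col k ⬝ᵥ X.col k := by
  rw [h.col_dotProduct_self, Finset.mul_sum]
  refine Finset.sum_le_sum fun i _ => ?_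
  have := sigmaMin_le s i
  gcongr

theorem sq_mulVec_le (V : Matrix (Fin q) (Fin r) ℝ) (x : Fin r → ℝ) (k : Fin q) :
    (V *ᵥ x) k ^ 2 ≤ (∑ i, V k i ^ 2) * ‖WithLp.toLp 2 x‖ ^ 2 := by
  rw [norm_toLp_sq]
  have := Finset.sum_mul_sq_le_sq_mul_sq Finset.univ (V k) x
  simpa only [mulVec, dotProduct, ← pow_two] using this

open scoped Matrix.Norms.L2Operator in
/-- The conclusion of the main theorem on the event where the truncation level is large enough, the
signal part is well conditioned and the noise part is small. -/
theorem SD₂_initMatrix_le {m : ℕ} (h : IsSVD X U s V) (hmin : 0 < sigmaMin s)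
    {σ : ℝ≥0} {κ μ δ : ℝ} (hδ : 0 < δ) (hδ1 : δ ≤ 1) (A : Fin q → Matrix (Fin m) (Fin n) ℝ)
    (y : Fin q × Fin m → ℝ)
    (hα : ∀ k, (colVar X σ k : ℝ) ≤ truncLevel κ μ fun k i => y (k, i))
    (hmid : ∀ x : Fin r → ℝ,
      1 / 256 * ‖WithLp.toLp 2 x‖ ^ 2 ≤ ∑ k, midFraction X σ y k * (V *ᵥ x) k ^ 2)
    (hG : ‖noisePart X σ κ μ A y‖ ≤ δ * sigmaMin s / 2048) (U₀ : Matrix (Fin n) (Fin r) ℝ)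
    (hU₀ : IsTopLeftSingularVectors (initMatrix κ μ A fun k i => y (k, i)) U₀) :
    SD₂ U U₀ ≤ δ := by
  set D := signalWeight X σ κ μ y with hD
  have hX : initMatrix κ μ A (fun k i => y (k, i)) =
      U * (diagonal s * Vᵀ * diagonal D) + noisePart X σ κ μ A y := by
    rw [initMatrix_eq X σ, ← Matrix.mul_assoc, ← Matrix.mul_assoc, ← h.eq]
  have hγ : ∀ u : Fin r → ℝ, sigmaMin s / 1024 * ‖WithLp.toLp 2 u‖ ≤
      ‖WithLp.toLp 2 ((diagonal s * Vᵀ * diagonal D)ᵀ *ᵥ u)‖ := by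
    intro u
    set x := diagonal s *ᵥ u with hx
    set p := V *ᵥ x with hp
    have e1 : (diagonal s * Vᵀ * diagonal D)ᵀ *ᵥ u = diagonal D *ᵥ p := by
      simp only [hp, hx, transpose_mul, transpose_transpose, diagonal_transpose, mulVec_mulVec]
    have e2 : sigmaMin s * ‖WithLp.toLp 2 u‖ ≤ ‖WithLp.toLp 2 x‖ := by
      refine (sq_le_sq₀ (by positivity) (norm_nonneg _)).1 ?_
      rw [mul_pow, norm_toLp_sq, norm_toLp_sq, dotProduct, dotProduct, Finset.mul_sum]
      refine Finset.sum_le_sum fun i _ => ?_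
      rw [hx, mulVec_diagonal]
      have h1 := sigmaMin_le s i
      have h2 : sigmaMin s ^ 2 ≤ s i ^ 2 := by gcongr
      nlinarith [mul_self_nonneg (u i)]
    -- If column `k` has zero variance, row `k` of `V` vanishes and both sides are zero.
    have e3 : ∀ k, midFraction X σ y k * p k ^ 2 ≤ 4 * (p k * (diagonal D *ᵥ p) k) := by
      intro k
      rw [mulVec_diagonal]
      rcases eq_or_ne (colVar X σ k) 0 with h0 | h0
      · have h1 : X.col k ⬝ᵥ X.col k = 0 := by
          have h2 := coe_colVar X σ k
          rw [h0, NNReal.coe_zero] at h2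
          have h3 : 0 ≤ X.col k ⬝ᵥ X.col k := by rw [← norm_toLp_sq]; positivity
          nlinarith [sq_nonneg (σ : ℝ)]
        have h4 := h.sigmaMin_sq_mul_row_le hmin.le k
        rw [h1] at h4
        have h5 : ∑ i, V k i ^ 2 ≤ 0 := nonpos_of_mul_nonpos_right h4 (by positivity)
        have h6 := sq_mulVec_le V x k
        have h7 : p k ^ 2 ≤ 0 := h6.trans (mul_nonpos_of_nonpos_of_nonneg h5 (by positivity))
        have h8 : p k = 0 := by nlinarith [sq_nonneg (p k)]
        rw [h8]; simp
      · have := midFraction_le_signalWeight X σ κ μ y k h0 (hα k)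
        nlinarith [sq_nonneg (p k)]
    have e4 : 1 / 256 * ‖WithLp.toLp 2 x‖ ^ 2 ≤
        4 * (‖WithLp.toLp 2 x‖ * ‖WithLp.toLp 2 (diagonal D *ᵥ p)‖) := by
      refine (hmid x).trans ((Finset.sum_le_sum fun k _ => e3 k).trans ?_)
      rw [← Finset.mul_sum, ← norm_toLp_mulVec_of_orthonormal V h.right_orthonormal x]
      refine mul_le_mul_of_nonneg_left ?_ (by norm_num)
      have := real_inner_le_norm (WithLp.toLp 2 p) (WithLp.toLp 2 (diagonal D *ᵥ p))
      rwa [← dotProduct_eq_inner_toLp] at this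
    rw [e1]
    rcases (norm_nonneg (WithLp.toLp 2 x)).eq_or_lt with h0 | h0
    · rw [← h0] at e2
      have := norm_nonneg (WithLp.toLp 2 (diagonal D *ᵥ p))
      linarith
    · have : 1 / 1024 * ‖WithLp.toLp 2 x‖ ≤ ‖WithLp.toLp 2 (diagonal D *ᵥ p)‖ := by
        refine le_of_mul_le_mul_left ?_ h0
        linarith
      linarith
  have h1 : δ * sigmaMin s / 2048 ≤ sigmaMin s / 2048 := by
    have := mul_le_of_le_one_left hmin.le hδ1
    gcongr
  refine (SD₂_le_of_perturbation U h.left_orthonormal _ _ _ hX hγ hG (by linarith) U₀ hU₀).trans ?_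
  -- With `γ = σ_min / 1024` and `η = δ σ_min / 2048` the ratio is `δ / (2 - δ) ≤ δ`.
  rw [div_le_iff₀ (by linarith)]
  nlinarith

end SingularValues

/-! ### Net cardinalities and union bounds. -/

section Counting

theorem one_add_pow_le_exp (a : ℝ) (ha : 0 ≤ a) (d : ℕ) : (1 + a) ^ d ≤ Real.exp (a * d) := by
  rw [mul_comm, Real.exp_nat_mul]
  have := Real.add_one_le_exp a
  gcongr
  linarith

theorem measure_biUnion_le_exp {Ω ι : Type*} [MeasurableSpace Ω] (P : Measure Ω) (T : Finset ι)
    (B : ι → Set Ω) {a b c : ℝ} (hT : (T.card : ℝ) ≤ Real.exp a)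
    (hB : ∀ i ∈ T, P (B i) ≤ ENNReal.ofReal (Real.exp (-b))) (hc : a + c ≤ b) :
    P (⋃ i ∈ T, B i) ≤ ENNReal.ofReal (Real.exp (-c)) := by
  refine (measure_biUnion_finset_le T B).trans ((Finset.sum_le_sum hB).trans ?_)
  rw [Finset.sum_const, nsmul_eq_mul, ← ENNReal.ofReal_natCast,
    ← ENNReal.ofReal_mul (by positivity)]
  refine ENNReal.ofReal_le_ofReal ?_
  calc (T.card : ℝ) * Real.exp (-b) ≤ Real.exp a * Real.exp (-b) := by gcongr
    _ = Real.exp (a - b) := by rw [← Real.exp_add]; ring_nf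
    _ ≤ _ := Real.exp_le_exp.2 (by linarith)

end Counting
-- Incoherence, sample size and assembly of the good event.
section Main
variable {n q r : ℕ} {X : Matrix (Fin n) (Fin q) ℝ} {U : Matrix (Fin n) (Fin r) ℝ}
  {s : Fin r → ℝ} {V : Matrix (Fin q) (Fin r) ℝ} {μ : ℝ}

theorem one_le_kappa (hr : 1 ≤ r) (hmin : 0 < sigmaMin s) : 1 ≤ kappa s := by
  rw [kappa, one_le_div hmin]
  exact (sigmaMin_le s ⟨0, hr⟩).trans (le_sigmaMax s ⟨0, hr⟩)

theorem IsSVD.col_dotProduct_self_le (h : IsSVD X U s V) (hμ : Incoherent s V μ)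
    (hmin : 0 < sigmaMin s) (k : Fin q) :
    X.col k ⬝ᵥ X.col k ≤ kappa s ^ 2 * μ ^ 2 * (r * sigmaMin s ^ 2 / q) := by
  rw [← norm_toLp_sq, h.norm_col]
  have h1 := pow_le_pow_left₀ (norm_nonneg _) (hμ k) 2
  refine h1.trans_eq ?_
  rw [mul_pow, mul_pow, Real.sq_sqrt (by positivity), kappa]
  field_simp

theorem IsSVD.sq_row_le (h : IsSVD X U s V) (hμ : Incoherent s V μ)
    (hmin : 0 < sigmaMin s) (k : Fin q) :
    ∑ i, V k i ^ 2 ≤ kappa s ^ 2 * μ ^ 2 * (r / q) := by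
  have h1 := (h.sigmaMin_sq_mul_row_le hmin.le k).trans (h.col_dotProduct_self_le hμ hmin k)
  have h2 : 0 < sigmaMin s ^ 2 := by positivity
  refine le_of_mul_le_mul_left (h1.trans_eq ?_) h2
  ring

theorem IsSVD.sum_colVar (h : IsSVD X U s V) (σ : ℝ≥0) :
    ∑ k, (colVar X σ k : ℝ) = ∑ i, s i ^ 2 + q * (σ : ℝ) ^ 2 := by
  simp only [coe_colVar, Finset.sum_add_distrib, h.sum_col_dotProduct_self, Finset.sum_const,
    Finset.card_univ, Fintype.card_fin, nsmul_eq_mul]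

/-- This explains the factor `κ² μ²` in the truncation level. Incoherence gives `‖x_k‖² ≤ κ² μ² r
σ_min² / q`, where `r σ_min²` is at most the squared Frobenius norm; the noise variance is the same
in all columns. -/
theorem IsSVD.colVar_le (h : IsSVD X U s V) (hμ : Incoherent s V μ) (hμ1 : 1 ≤ μ) (hr : 1 ≤ r)
    (hmin : 0 < sigmaMin s) (σ : ℝ≥0) (k : Fin q) :
    (colVar X σ k : ℝ) ≤ kappa s ^ 2 * μ ^ 2 * ((∑ k, (colVar X σ k : ℝ)) / q) := by
  have hq : (0 : ℝ) < q := by exact_mod_cast k.pos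
  have h1 := h.col_dotProduct_self_le hμ hmin k
  have h2 : (r : ℝ) * sigmaMin s ^ 2 ≤ ∑ i, s i ^ 2 := by
    have : ∑ _i : Fin r, sigmaMin s ^ 2 ≤ ∑ i, s i ^ 2 := Finset.sum_le_sum fun i _ => by
      have := sigmaMin_le s i
      gcongr
    simpa using this
  have h3 : 1 ≤ kappa s ^ 2 * μ ^ 2 :=
    one_le_mul_of_one_le_of_one_le (one_le_pow₀ (one_le_kappa hr hmin)) (one_le_pow₀ hμ1)
  rw [coe_colVar, h.sum_colVar, add_div, mul_div_cancel_left₀ _ hq.ne', mul_add]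
  refine add_le_add (h1.trans ?_) (le_mul_of_one_le_left (sq_nonneg _) h3)
  gcongr

theorem IsSVD.sum_colVar_le (h : IsSVD X U s V) (hmin : 0 < sigmaMin s) (σ : ℝ≥0) :
    ∑ k, (colVar X σ k : ℝ) ≤ sigmaMin s ^ 2 * (r * kappa s ^ 2 + NSR q σ s) := by
  have h2 : ∑ i, s i ^ 2 ≤ r * sigmaMax s ^ 2 := by
    have : ∑ i, s i ^ 2 ≤ ∑ _i : Fin r, sigmaMax s ^ 2 := Finset.sum_le_sum fun i _ => by
      have := le_sigmaMax s i
      have := h.nonneg i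
      gcongr
    simpa using this
  rw [h.sum_colVar, NSR, kappa]
  have e : sigmaMin s ^ 2 * (r * (sigmaMax s / sigmaMin s) ^ 2 +
      q * (σ : ℝ) ^ 2 / sigmaMin s ^ 2) = r * sigmaMax s ^ 2 + q * (σ : ℝ) ^ 2 := by
    field_simp
  rw [e]
  gcongr

variable {Ω : Type*} [MeasurableSpace Ω] {P : Measure Ω} [IsProbabilityMeasure P] {m : ℕ}
  {σ : ℝ≥0} {A : Fin q → Ω → Matrix (Fin m) (Fin n) ℝ} {v : Fin q → Ω → Fin m → ℝ}

theorem IsGaussianModel.measure_quadratic_lt (hM : IsGaussianModel P σ A v) (h : IsSVD X U s V)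
    (hμ : Incoherent s V μ) (hμ1 : 1 ≤ μ) (hr : 1 ≤ r) (hmin : 0 < sigmaMin s) (hm : 0 < m)
    (hq : 0 < q) (x : Fin r → ℝ) (hx : ‖WithLp.toLp 2 x‖ = 1) :
    P {ω | ∑ k, midFraction X σ (fun j => obs X A v j ω) k * (V *ᵥ x) k ^ 2 < 1 / 40} ≤
      ENNReal.ofReal (Real.exp (-(m * q / (kappa s ^ 2 * μ ^ 2) / r / 40))) := by
  have hq' : (0 : ℝ) < q := by exact_mod_cast hq
  have hr' : (0 : ℝ) < r := by exact_mod_cast hr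
  have hκ : 0 < kappa s := zero_lt_one.trans_le (one_le_kappa hr hmin)
  have hp : ∀ k, (V *ᵥ x) k ^ 2 ≤ ∑ i, V k i ^ 2 := fun k => by
    have := sq_mulVec_le V x k
    rwa [hx, one_pow, mul_one] at this
  -- The largest `l` that the row bound `IsSVD.sq_row_le` allows.
  refine (hM.measure_midFraction_le hm X (V *ᵥ x) (l := q / (kappa s ^ 2 * μ ^ 2 * r))
    ?_ (by positivity) (fun k => ?_) (fun k hk => ?_)).trans_eq ?_
  · have h1 := norm_toLp_mulVec_of_orthonormal V h.right_orthonormal x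
    have h2 := norm_toLp_sq (V *ᵥ x)
    rw [h1, hx, one_pow, dotProduct] at h2
    simpa only [← pow_two] using h2.symm
  · have h1 := (hp k).trans (h.sq_row_le hμ hmin k)
    have h2 : q / (kappa s ^ 2 * μ ^ 2 * r) * (kappa s ^ 2 * μ ^ 2 * (r / q)) = 1 := by
      field_simp
    rw [← h2]
    gcongr
  · have h1 := h.sigmaMin_sq_mul_row_le hmin.le k
    have h2 := coe_colVar X σ k
    rw [hk, NNReal.coe_zero] at h2
    have h3 : sigmaMin s ^ 2 * ∑ i, V k i ^ 2 ≤ 0 := by nlinarith [sq_nonneg (σ : ℝ)]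
    have h4 := (hp k).trans (nonpos_of_mul_nonpos_right h3 (by positivity))
    exact pow_eq_zero_iff two_ne_zero |>.1 (le_antisymm h4 (sq_nonneg _))
  · congr 3
    field_simp

-- With effective sample size `M = mq / (κ² μ²)`, the energy bounds fail with probability at most
-- `exp (-M/2)` and `exp (-M/8)`, the signal bound at a net point with `exp (-M / (40 r))`, and the
-- noise bound with an exponent proportional to `M δ² / (r κ² + NSR)`. The hypothesis makes each
-- beat its net and leave `exp (-2N)`, where `N = n + q`.
set_option maxHeartbeats 1000000 in
open scoped Matrix.Norms.L2Operator in
theorem exists_event (hr : 1 ≤ r) (hX : X.rank = r) (h : IsSVD X U s V) (hμ1 : 1 ≤ μ)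
    (hμ : Incoherent s V μ) (hM : IsGaussianModel P σ A v) {δ : ℝ} (hδ : 0 < δ) (hδ1 : δ ≤ 1)
    (hmq : (m : ℝ) * q > 10 ^ 11 * μ ^ 2 * kappa s ^ 2 *
      (max (n : ℝ) q * r * (kappa s ^ 2 / δ ^ 2) + max (n : ℝ) q / δ ^ 2 * NSR q σ s)) :
    ∃ E : Set Ω, MeasurableSet E ∧ 1 - Real.exp (-(1 / 2) * ((n : ℝ) + q)) ≤ P.real E ∧
      ∀ ω ∈ E, ∀ U₀ : Matrix (Fin n) (Fin r) ℝ,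
        IsTopLeftSingularVectors (initMatrix (kappa s) μ (fun k => A k ω)
          (measurements X (fun k => A k ω) (fun k => v k ω))) U₀ → SD₂ U U₀ ≤ δ := by
  have hmin := sigmaMin_pos hr (h.pos_of_rank_eq hX)
  have hκ1 := one_le_kappa hr hmin
  have hrn : r ≤ n := hX ▸ Matrix.rank_le_height X
  have hrq : r ≤ q := hX ▸ Matrix.rank_le_width X
  have hq0 : 0 < q := by omega
  set κ := kappa s with hκ
  set L : ℝ := max (n : ℝ) q with hL
  set N : ℝ := (n : ℝ) + q with hN
  have hr' : (1 : ℝ) ≤ r := by exact_mod_cast hr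
  have hnL : (n : ℝ) ≤ L := le_max_left _ _
  have hqL : (q : ℝ) ≤ L := le_max_right _ _
  have hrL : (r : ℝ) ≤ L := le_trans (by exact_mod_cast hrq) hqL
  have hrn' : (r : ℝ) ≤ n := by exact_mod_cast hrn
  have hq' : (0 : ℝ) < q := by exact_mod_cast hq0
  have hL1 : 1 ≤ L := hr'.trans hrL
  have hN2 : 2 ≤ N := by
    have : (r : ℝ) ≤ q := by exact_mod_cast hrq
    linarith
  have hNSR : 0 ≤ NSR q σ s := by rw [NSR]; positivity
  have hκ0 : 0 < κ := zero_lt_one.trans_le hκ1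
  have hμ0 : 0 < μ := zero_lt_one.trans_le hμ1
  have hK : 0 < κ ^ 2 * μ ^ 2 := by positivity
  set M : ℝ := m * q / (κ ^ 2 * μ ^ 2) with hMdef
  have hM2 : 10 ^ 11 * (L * (r * κ ^ 2 + NSR q σ s)) ≤ M * δ ^ 2 := by
    have e : M * δ ^ 2 = m * q * δ ^ 2 / (κ ^ 2 * μ ^ 2) := by rw [hMdef]; ring
    rw [e, le_div_iff₀ hK]
    have h1 := mul_le_mul_of_nonneg_right hmq.le (sq_nonneg δ)
    refine le_trans (le_of_eq ?_) h1
    field_simp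
  have hM0 : 0 ≤ M := by positivity
  have hM1 : 10 ^ 11 * (L * r) ≤ M := by
    have h1 : M * δ ^ 2 ≤ M := mul_le_of_le_one_right hM0 (pow_le_one₀ hδ.le hδ1)
    have h2 : (r : ℝ) ≤ r * κ ^ 2 + NSR q σ s := by
      have : (r : ℝ) ≤ r * κ ^ 2 := le_mul_of_one_le_right (by positivity) (one_le_pow₀ hκ1)
      linarith
    have h3 : L * r ≤ L * (r * κ ^ 2 + NSR q σ s) := by gcongr
    linarith
  have hm0 : 0 < m := by
    rcases Nat.eq_zero_or_pos m with h0 | h0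
    · have h1 : M = 0 := by rw [hMdef, h0]; simp
      have : 0 < L * r := by positivity
      linarith
    · exact h0
  have hm' : (0 : ℝ) < m := by exact_mod_cast hm0
  have hML : 10 ^ 11 * L ≤ M := by
    have : L ≤ L * r := le_mul_of_one_le_right (by positivity) hr'
    linarith
  -- the variance scale
  set T : ℝ := ∑ k, (colVar X σ k : ℝ) with hT
  have hTpos : 0 < T := by
    have h1 : ∑ i, s i ^ 2 ≥ s ⟨0, hr⟩ ^ 2 :=
      Finset.single_le_sum (f := fun i => s i ^ 2) (fun i _ => sq_nonneg _) (Finset.mem_univ _)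
    have h2 : 0 < s ⟨0, hr⟩ ^ 2 := by
      have := h.pos_of_rank_eq hX ⟨0, hr⟩
      positivity
    rw [hT, h.sum_colVar]
    exact add_pos_of_pos_of_nonneg (h2.trans_le h1) (by positivity)
  set R : ℝ := κ ^ 2 * μ ^ 2 * (T / q) with hR
  have hRpos : 0 < R := by positivity
  have hcol : ∀ k, (colVar X σ k : ℝ) ≤ R := h.colVar_le hμ hμ1 hr hmin σ
  have hTR : m * T = M * R := by
    rw [hMdef, hR]
    field_simp
  -- the nets
  obtain ⟨T₃, hT₃s, hT₃c, hT₃n⟩ := exists_net (d := r) (ε := 1 / 16) (by norm_num)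
    {x | ‖x‖ = 1} (fun x hx => le_of_eq hx)
  obtain ⟨T₁, hT₁s, hT₁c, hT₁n⟩ := exists_net (d := n) (ε := 1 / 4) (by norm_num)
    {x | ‖x‖ ≤ 1} (fun x hx => hx)
  obtain ⟨T₂, hT₂s, hT₂c, hT₂n⟩ := exists_net (d := q) (ε := 1 / 4) (by norm_num)
    {x | ‖x‖ ≤ 1} (fun x hx => hx)
  norm_num at hT₁n hT₂n hT₃n
  set t : ℝ := δ * sigmaMin s / 4096 with ht
  -- the exceptional events
  set B₁ : Set Ω := {ω | 4 * (m * T) ≤ ∑ j, obs X A v j ω ^ 2} with hB₁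
  set B₂ : Set Ω := {ω | ∑ j, obs X A v j ω ^ 2 ≤ (m * T) / 4} with hB₂
  set B₃ : EuclideanSpace ℝ (Fin r) → Set Ω := fun x =>
    {ω | ∑ k, midFraction X σ (fun j => obs X A v j ω) k * (V *ᵥ x.ofLp) k ^ 2 < 1 / 40} with hB₃
  set B₄ : EuclideanSpace ℝ (Fin n) × EuclideanSpace ℝ (Fin q) → Set Ω := fun p =>
    {ω | truncLevel κ μ (fun k i => obs X A v (k, i) ω) ≤ 36 * R ∧
      t ≤ p.1.ofLp ⬝ᵥ noisePart X σ κ μ (fun k => A k ω) (fun j => obs X A v j ω) *ᵥ p.2.ofLp}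
    with hB₄
  set B : Set Ω := B₁ ∪ B₂ ∪ ((⋃ x ∈ T₃, B₃ x) ∪ ⋃ p ∈ T₁ ×ˢ T₂, B₄ p) with hB
  have hNL : N ≤ 2 * L := by linarith
  have p₁ : P B₁ ≤ ENNReal.ofReal (Real.exp (-(2 * N))) := by
    refine (hM.measure_energy_ge X hRpos hcol).trans
      (ENNReal.ofReal_le_ofReal (Real.exp_le_exp.2 ?_))
    rw [← hT, hTR, neg_div, neg_le_neg_iff, mul_div_mul_right _ _ hRpos.ne']
    linarith
  have p₂ : P B₂ ≤ ENNReal.ofReal (Real.exp (-(2 * N))) := by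
    refine (hM.measure_energy_le X hRpos hcol).trans
      (ENNReal.ofReal_le_ofReal (Real.exp_le_exp.2 ?_))
    rw [← hT, hTR, neg_div, neg_le_neg_iff, mul_div_mul_right _ _ hRpos.ne']
    linarith
  have p₃ : P (⋃ x ∈ T₃, B₃ x) ≤ ENNReal.ofReal (Real.exp (-(2 * N))) := by
    have hcard : (T₃.card : ℝ) ≤ Real.exp (32 * r) := by
      refine hT₃n.trans ?_
      have := one_add_pow_le_exp 32 (by norm_num) r
      norm_num at this
      exact this
    refine measure_biUnion_le_exp P T₃ B₃ (b := M / r / 40) hcard (fun x hx => ?_) ?_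
    · exact hM.measure_quadratic_lt h hμ hμ1 hr hmin hm0 hq0 x.ofLp (hT₃s x hx)
    · have : 10 ^ 11 * L ≤ M / r := by
        rw [le_div_iff₀ (by positivity)]; linarith
      linarith
  have p₄ : P (⋃ p ∈ T₁ ×ˢ T₂, B₄ p) ≤ ENNReal.ofReal (Real.exp (-(2 * N))) := by
    have hcard : ((T₁ ×ˢ T₂).card : ℝ) ≤ Real.exp (8 * N) := by
      rw [Finset.card_product, Nat.cast_mul, hN, mul_add, Real.exp_add]
      have h1 := one_add_pow_le_exp 8 (by norm_num) n
      have h2 := one_add_pow_le_exp 8 (by norm_num) q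
      norm_num at h1 h2
      exact mul_le_mul (hT₁n.trans h1) (hT₂n.trans h2) (by positivity) (by positivity)
    refine measure_biUnion_le_exp P _ B₄ (b := t ^ 2 * m / (2 * (36 * R))) hcard
      (fun p hp => ?_) ?_
    · obtain ⟨hp1, hp2⟩ := Finset.mem_product.1 hp
      refine hM.measure_noisePart_ge hm0 X κ μ p.1.ofLp p.2.ofLp ?_ ?_ (by positivity)
        (by positivity)
      · rw [← norm_toLp_sq]
        exact pow_le_one₀ (norm_nonneg _) (hT₁s _ hp1)
      · rw [← norm_toLp_sq]
        exact pow_le_one₀ (norm_nonneg _) (hT₂s _ hp2)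
    · have h1 := h.sum_colVar_le hmin σ
      rw [← hT, ← hκ] at h1
      -- `8 N` pays for the nets and `2 N` remains. This step sets the size of the constant: `720 ·
      -- 2 · 4096² ≈ 2.4 · 10^10 < 10^11`.
      have h2 : 10 * N * (2 * (36 * R)) ≤ t ^ 2 * m := by
        have e1 : t ^ 2 * m = M * δ ^ 2 * (sigmaMin s ^ 2 * (κ ^ 2 * μ ^ 2 / q)) / 4096 ^ 2 := by
          rw [ht, hMdef]
          field_simp
        have e2 : R ≤ (sigmaMin s ^ 2 * (κ ^ 2 * μ ^ 2 / q)) * (r * κ ^ 2 + NSR q σ s) := by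
          rw [hR]
          calc κ ^ 2 * μ ^ 2 * (T / q) ≤ κ ^ 2 * μ ^ 2 *
              (sigmaMin s ^ 2 * (r * κ ^ 2 + NSR q σ s) / q) := by gcongr
            _ = _ := by ring
        set W := sigmaMin s ^ 2 * (κ ^ 2 * μ ^ 2 / q) with hW
        have hW0 : 0 < W := by positivity
        set Q := (r : ℝ) * κ ^ 2 + NSR q σ s with hQ
        have hQ0 : 0 ≤ Q := by positivity
        have e3 := mul_le_mul_of_nonneg_right hM2 hW0.le
        have e4 : N * R ≤ 2 * L * (W * Q) := by gcongr
        have e5 : 0 ≤ L * (W * Q) := by positivity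
        rw [e1, le_div_iff₀ (by norm_num)]
        linarith
      rw [le_div_iff₀ (by positivity)]
      linarith
  have pB : P B ≤ ENNReal.ofReal (Real.exp (-(1 / 2) * N)) := by
    have h1 : P B ≤ ENNReal.ofReal (Real.exp (-(2 * N))) + ENNReal.ofReal (Real.exp (-(2 * N))) +
        (ENNReal.ofReal (Real.exp (-(2 * N))) + ENNReal.ofReal (Real.exp (-(2 * N)))) := by
      refine (measure_union_le _ _).trans (add_le_add ?_ ?_)
      · exact (measure_union_le _ _).trans (add_le_add p₁ p₂)
      · exact (measure_union_le _ _).trans (add_le_add p₃ p₄)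
    refine h1.trans ?_
    rw [← ENNReal.ofReal_add (by positivity) (by positivity),
      ← ENNReal.ofReal_add (by positivity) (by positivity)]
    refine ENNReal.ofReal_le_ofReal ?_
    have h2 : Real.exp (-(1 / 2) * N) = Real.exp (3 / 2 * N) * Real.exp (-(2 * N)) := by
      rw [← Real.exp_add]; ring_nf
    -- Uses `N ≥ 2`, so that four failures of probability `exp (-2N)` fit into `exp (-N/2)`.
    have h3 : 4 ≤ Real.exp (3 / 2 * N) := by
      have := Real.add_one_le_exp (3 / 2 * N)
      linarith
    rw [h2]
    nlinarith [Real.exp_pos (-(2 * N))]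
  -- The model is only a.e. measurable, so `B` is replaced by a measurable hull of the same measure.
  refine ⟨(toMeasurable P B)ᶜ, (measurableSet_toMeasurable P B).compl, ?_, ?_⟩
  · rw [probReal_compl_eq_one_sub (measurableSet_toMeasurable P B)]
    have : P.real (toMeasurable P B) ≤ Real.exp (-(1 / 2) * N) := by
      rw [Measure.real, measure_toMeasurable]
      exact ENNReal.toReal_le_of_le_ofReal (Real.exp_pos _).le pB
    linarith
  · intro ω hω U₀ hU₀
    have hωB : ω ∉ B := fun hb => hω (subset_toMeasurable P B hb)
    simp only [hB, Set.mem_union, not_or, Set.mem_iUnion, not_exists] at hωB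
    obtain ⟨⟨n₁, n₂⟩, n₃, n₄⟩ := hωB
    set y : Fin q × Fin m → ℝ := fun j => obs X A v j ω with hy
    have n₁' : ∑ j, y j ^ 2 < 4 * (m * T) := not_le.1 n₁
    have n₂' : m * T / 4 < ∑ j, y j ^ 2 := not_le.1 n₂
    have hα : truncLevel κ μ (fun k i => y (k, i)) = 9 * R / (m * T) * ∑ j, y j ^ 2 := by
      rw [truncLevel_eq, hR]
      congr 1
      field_simp
    have hmT : 0 < m * T := by positivity
    have hα_le : truncLevel κ μ (fun k i => y (k, i)) ≤ 36 * R := by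
      rw [hα, div_mul_eq_mul_div, div_le_iff₀ hmT]
      have := mul_le_mul_of_nonneg_left n₁'.le hRpos.le
      linarith
    have hα_ge : R ≤ truncLevel κ μ (fun k i => y (k, i)) := by
      rw [hα, div_mul_eq_mul_div, le_div_iff₀ hmT]
      have := mul_le_mul_of_nonneg_left n₂'.le hRpos.le
      have := mul_pos hRpos hmT
      linarith
    refine SD₂_initMatrix_le (m := m) h hmin (σ := σ) (κ := κ) (μ := μ) hδ hδ1
      (fun k => A k ω) y (fun k => (hcol k).trans hα_ge) ?_ ?_ U₀ hU₀
    · refine quadratic_lower_bound_of_net V h.right_orthonormal _ (midFraction_nonneg X σ y)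
        (midFraction_le_one hm0 X σ y) T₃ hT₃c (fun x hx => ?_)
      exact not_lt.1 (n₃ x hx)
    · have : δ * sigmaMin s / 2048 = 2 * t := by rw [ht]; ring
      rw [this]
      refine l2_opNorm_le_of_nets _ (by positivity) T₁ T₂ hT₁c hT₂s hT₂c fun w hw z hz => ?_
      have := n₄ (w, z) (Finset.mem_product.2 ⟨hw, hz⟩)
      by_contra! hlt
      exact this ⟨hα_le, hlt.le⟩

end Main
end LRCS

theorem mainTheorem2 :
    ∃ c C : ℝ, 0 < c ∧ c < 1 ∧ 1 ≤ C ∧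
      ∀ (Ω : Type*) [MeasurableSpace Ω] (P : Measure Ω) [IsProbabilityMeasure P]
        (n q m r : ℕ) (σ : ℝ≥0) (μ δ₀ : ℝ)
        (Xstar : Matrix (Fin n) (Fin q) ℝ) (Ustar : Matrix (Fin n) (Fin r) ℝ)
        (s : Fin r → ℝ) (Vstar : Matrix (Fin q) (Fin r) ℝ)
        (A : Fin q → Ω → Matrix (Fin m) (Fin n) ℝ) (v : Fin q → Ω → Fin m → ℝ),
        1 ≤ r → Xstar.rank = r → LRCS.IsSVD Xstar Ustar s Vstar →
        1 ≤ μ → LRCS.Incoherent s Vstar μ →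
        LRCS.IsGaussianModel P σ A v →
        0 < δ₀ → δ₀ < 0.1 →
        (m : ℝ) * q > C * μ ^ 2 * LRCS.kappa s ^ 2 *
          (max (n : ℝ) q * r * (LRCS.kappa s ^ 2 / δ₀ ^ 2) +
            max (n : ℝ) q / δ₀ ^ 2 * LRCS.NSR q σ s) →
        ∃ E : Set Ω, MeasurableSet E ∧
          1 - Real.exp (-c * ((n : ℝ) + q)) ≤ P.real E ∧
          ∀ ω ∈ E, ∀ U₀ : Matrix (Fin n) (Fin r) ℝ,
            LRCS.IsTopLeftSingularVectors
              (LRCS.initMatrix (LRCS.kappa s) μ (fun k => A k ω)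
                (LRCS.measurements Xstar (fun k => A k ω) (fun k => v k ω))) U₀ →
            LRCS.SD₂ Ustar U₀ ≤ δ₀ := by
  refine ⟨1 / 2, 10 ^ 11, by norm_num, by norm_num, by norm_num, ?_⟩
  intro Ω _ P _ n q m r σ μ δ₀ Xstar Ustar s Vstar A v hr hX h hμ1 hμ hM hδ hδ1 hmq
  exact LRCS.exists_event hr hX h hμ1 hμ hM hδ (hδ1.le.trans (by norm_num)) hmq
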